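/- **Setting.** Let $m:\mathbb R^{n_x}\to\mathbb R$ and $g:\mathbb R^{n_u}\to\mathbb R$ be convex, $m$ of class $C^1$, $G:\mathbb R^{n_x}\to\mathbb R^{n_G}$ affine, $A_c\in\mathbb R^{n_x\times n_x}$, $B_c\in\mathbb R^{n_x\times n_u}$, $\rho_{\min},\rho_{\max}\in\mathbb R$, $t_f>0$, $N\ge 1$, $x_s\in\mathbb R^{n_x}$, and $u_s\in\mathbb R^{n_u}$ with $g(u_s)=\rho_{\min}$. For $t_s\in[0,t_f)$ put $$A(t_s)=e^{A_c (t_f-t_s)/N},\quad B(t_s)=\int_0^{(t_f-t_s)/N}e^{A_c\tau}d\tau\,B_c,\quad x_{\rm init}(t_s)=e^{A_c t_s}x_s+\int_0^{t_s}e^{A_c\tau}d\tau\,B_c u_s .$$ For $l:\mathbb R\to\mathbb R$, let $\mathcal P(t_s)$ be the problem $$\min_{x,u,\sigma}\ m(x_{N+1})+\sum_{i=1}^N l(\sigma_i)\tfrac{t_f-t_s}{N}+t_s\,l(\rho_{\min})$$ subject to $x_{i+1}=A(t_s)x_i+B(t_s)u_i$, $\rho_{\min}\le\sigma_i\le\rho_{\max}$,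 $g(u_i)\le\sigma_i$ ($1\le i\le N$), $x_1=x_{\rm init}(t_s)$, $G(x_{N+1})=0$. Let $v(t_s)$ be its optimal value, and $m^*$ the optimal value of $\min\{m(x): G(x)=0\}$. Let $\mathcal P_0$ be the problem with the constraints of $\mathcal P(0)$ and objective $m(x_{N+1})+\sum_i l_i(\sigma_i)$, where each $l_i$ is $C^1$ and monotonically increasing on $[\rho_{\min},\infty)$. **Assumptions.** (i) (Long-horizon case.) $\mathcal P_0$ has an optimal solution with $\sigma_i=\rho_{\min}$ for all $i$ whose $x_{N+1}$ minimizes $m$ over $\{G=0\}$. (ii) There is $t_b\in(0,t_f)$ with $v(t_b)>m^*+t_f\,l(\rho_{\min})$. (iii) $l$ is $C^1$ and monotonically increasing on $[\rho_{\min},\infty)$, $\{u: g(u)\le\rho_{\min}\}$ is nonempty and $\{u:g(u)\le\rho_{\max}\}$ is compact; and for every $t_s\in[0,t_b]$: the pair $(A(t_s),B(t_s))$ is controllable, the Jacobian of the equality constraints of $\mathcal P(t_s)$ (as functions of $(x,u,\sigma)$) has full row rank, and there is a point satisfying the equality constraints of $\mathcal P(t_s)$ in the interior of the set described by its inequality constraints.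 (iv) For some $L_l>0$, $l'(\sigma)\ge L_l$ for all $\sigma\in[\rho_{\min},\rho_{\max}]$. **Perturbation.** Let $A(t_s)=Q^{-1}JQ$ be a Jordan form over $\mathbb C$, and $\lambda_1,\dots,\lambda_d$ the distinct eigenvalues. Let $S\subseteq\mathbb R^d$ be the subspace of those $q$ that give equal shifts to complex conjugate eigenvalues ($S=\mathbb R^d$ if all eigenvalues are real). For $q\in S$ let $\tilde A(q)=Q^{-1}\tilde J Q$, where $\tilde J$ arises from $J$ by replacing each diagonal entry $\lambda_k$ by $\lambda_k+q_k$; let $\mathcal P(t_s,q)$ be $\mathcal P(t_s)$ with $A(t_s)$ replaced by $\tilde A(q)$. For a control $u$, let $\tilde x_{N+1}$ be the end point of the trajectory of the unperturbed dynamics, $\tilde x_1=x_{\rm init}(t_s)$, $\tilde x_{i+1}=A(t_s)\tilde x_i+B(t_s)u_i$. **Theorem.** For every $\epsilon>0$ there is $t_s^*\in(0,t_b)$ such that, for every Jordan form of $A(t_s^*)$ and every $\gamma>0$, there is $\delta>0$ with the following properties. 1. For every $q\in S$ with $\|q\|<\delta$, the matrix $\tilde A(q)$ is real, $\mathcal P(t_s^*,q)$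 has an optimal solution, and every optimal solution $(x,u,\sigma)$ satisfies $\|G(\tilde x_{N+1})\|\le\gamma$, $g(u_i)<\rho_{\min}+\epsilon$ for all $i$, and $m(\tilde x_{N+1})<m^*+\epsilon$. 2. If $q$ is uniformly distributed on $\{q\in S:\|q\|<\delta\}$, then with probability one, for every optimal solution $(x,u,\sigma)$ of $\mathcal P(t_s^*,q)$, the inequality $g(u_i)\ge\rho_{\min}$ fails for at most $n_x-1$ indices $i$. -/

import Mathlib

open scoped Matrix ComplexConjugate
open Set MeasureTheory

noncomputable section

namespace LCvx

/-- Euclidean space `ℝⁿ`. -/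
abbrev Vec (n : ℕ) : Type := EuclideanSpace ℝ (Fin n)

/-- Matrix acting on Euclidean vectors. -/
def mulE {k n : ℕ} (A : Matrix (Fin k) (Fin n) ℝ) (x : Vec n) : Vec k :=
  WithLp.toLp 2 (A *ᵥ WithLp.ofLp x)

/-- The decision variable `z = (x, u, σ)` with `x = (x₁, …, x_{N+1})`, `u = (u₁, …, u_N)`,
`σ = (σ₁, …, σ_N)`. -/
abbrev DecVar (nx nu N : ℕ) : Type :=
  (Fin (N + 1) → Vec nx) × (Fin N → Vec nu) × (Fin N → ℝ)

/-! ### The discrete relaxed optimal control problem -/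

/-- Data of the discrete problem
`min m(x_{N+1}) + ∑ cost_i(σ_i) + offset` subject to `x_{i+1} = A x_i + B u_i`,
`ρmin ≤ σ_i ≤ ρmax`, `g(u_i) ≤ σ_i`, `x₁ = xinit`, `G(x_{N+1}) = 0`. -/
structure DiscProblem (nx nu nG N : ℕ) where
  A : Matrix (Fin nx) (Fin nx) ℝ
  B : Matrix (Fin nx) (Fin nu) ℝ
  xinit : Vec nx
  m : Vec nx → ℝ
  cost : Fin N → ℝ → ℝ
  offset : ℝ
  g : Vec nu → ℝ
  G : Vec nx →ᵃ[ℝ] Vec nG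
  ρmin : ℝ
  ρmax : ℝ

namespace DiscProblem

variable {nx nu nG N : ℕ}

/-- The inequality constraints on one pair `(u_i, σ_i)`. -/
def V (P : DiscProblem nx nu nG N) : Set (Vec nu × ℝ) :=
  {p | P.ρmin ≤ p.2 ∧ p.2 ≤ P.ρmax ∧ P.g p.1 ≤ p.2}

/-- All inequality constraints on `z = (x, u, σ)`. -/
def Vtilde (P : DiscProblem nx nu nG N) : Set (DecVar nx nu N) :=
  {z | ∀ i, (z.2.1 i, z.2.2 i) ∈ P.V}

/-- All equality constraints, written as `H z = 0`. -/
def H (P : DiscProblem nx nu nG N) (z : DecVar nx nu N) :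
    Vec nx × (Fin N → Vec nx) × Vec nG :=
  (z.1 0 - P.xinit,
   fun i => z.1 i.succ - (mulE P.A (z.1 i.castSucc) + mulE P.B (z.2.1 i)),
   P.G (z.1 (Fin.last N)))

/-- The objective function. -/
def objective (P : DiscProblem nx nu nG N) (z : DecVar nx nu N) : ℝ :=
  P.m (z.1 (Fin.last N)) + ∑ i, P.cost i (z.2.2 i) + P.offset

/-- The feasible set. -/
def feasible (P : DiscProblem nx nu nG N) : Set (DecVar nx nu N) :=
  {z | P.H z = 0 ∧ z ∈ P.Vtilde}

/-- `z` is an optimal solution. -/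
def IsOptimal (P : DiscProblem nx nu nG N) (z : DecVar nx nu N) : Prop :=
  z ∈ P.feasible ∧ ∀ w ∈ P.feasible, P.objective z ≤ P.objective w

/-- The optimal value. -/
def value (P : DiscProblem nx nu nG N) : ℝ :=
  sInf (P.objective '' P.feasible)

/-- The state trajectory obtained by running the dynamics from `xinit` with the control `u`. -/
def trajectory (P : DiscProblem nx nu nG N) (u : Fin N → Vec nu) : Fin (N + 1) → Vec nx :=
  Fin.induction (motive := fun _ => Vec nx) P.xinit
    (fun i x => mulE P.A x + mulE P.B (u i))

/-- The end point of the propagated trajectory. -/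
def endpoint (P : DiscProblem nx nu nG N) (u : Fin N → Vec nu) : Vec nx :=
  P.trajectory u (Fin.last N)

/-- Replace the dynamics matrix `A` by `A'`, keeping everything else. -/
def withA (P : DiscProblem nx nu nG N) (A' : Matrix (Fin nx) (Fin nx) ℝ) :
    DiscProblem nx nu nG N :=
  { P with A := A' }

/-- Smoothness, monotonicity and compactness assumption. -/
structure RegularData (P : DiscProblem nx nu nG N) : Prop where
  cost_contDiffOn : ∀ i, ContDiffOn ℝ 1 (P.cost i) (Ici P.ρmin)
  cost_monotoneOn : ∀ i, MonotoneOn (P.cost i) (Ici P.ρmin)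
  m_contDiff : ContDiff ℝ 1 P.m
  nonempty_min : {u | P.g u ≤ P.ρmin}.Nonempty
  compact_max : IsCompact {u | P.g u ≤ P.ρmax}

/-- The controllability matrix `(B, AB, …, A^{nx-1}B)`. -/
def controllabilityMatrix (P : DiscProblem nx nu nG N) :
    Matrix (Fin nx) (Fin nx × Fin nu) ℝ :=
  Matrix.of fun i kj => (P.A ^ (kj.1 : ℕ) * P.B) i kj.2

/-- The pair `{A, B}` is controllable. -/
def Controllable (P : DiscProblem nx nu nG N) : Prop :=
  P.controllabilityMatrix.rank = nx

/-- The Jacobian of the equality constraints has full row rank. -/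
def FullRowRank (P : DiscProblem nx nu nG N) : Prop :=
  ∀ z, Function.Surjective (fderiv ℝ P.H z)

/-- Slater's condition. -/
def Slater (P : DiscProblem nx nu nG N) : Prop :=
  ∃ z ∈ interior P.Vtilde, P.H z = 0

/-- `x` solves `min m(x)` subject to `G(x) = 0`. -/
def SolvesTerminal (P : DiscProblem nx nu nG N) (x : Vec nx) : Prop :=
  P.G x = 0 ∧ ∀ y, P.G y = 0 → P.m x ≤ P.m y

/-- The long-horizon case: an optimal solution has `σ_i = ρmin` for all `i` and its final state
minimizes the terminal cost over the boundary condition. -/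
def LongHorizon (P : DiscProblem nx nu nG N) : Prop :=
  ∃ z, P.IsOptimal z ∧ (∀ i, z.2.2 i = P.ρmin) ∧ P.SolvesTerminal (z.1 (Fin.last N))

end DiscProblem

/-! ### The continuous-time system and the two-phase problem -/

/-- Data of the continuous-time problem with fixed horizon `tf`, together with the stage costs
`l₀ i` of the one-phase discretization, the stage cost `l` of the two-phase problem, and the
constant first-phase control `us`. -/
structure SystemData (nx nu nG N : ℕ) where
  Ac : Matrix (Fin nx) (Fin nx) ℝ
  Bc : Matrix (Fin nx) (Fin nu) ℝ
  m : Vec nx → ℝ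
  g : Vec nu → ℝ
  G : Vec nx →ᵃ[ℝ] Vec nG
  l₀ : Fin N → ℝ → ℝ
  l : ℝ → ℝ
  ρmin : ℝ
  ρmax : ℝ
  tf : ℝ
  xs : Vec nx
  us : Vec nu

namespace SystemData

variable {nx nu nG N : ℕ}

/-- `∫₀ᵗ exp(τ Ac) dτ`, entry by entry. -/
def expIntegral (D : SystemData nx nu nG N) (t : ℝ) : Matrix (Fin nx) (Fin nx) ℝ :=
  Matrix.of fun i j => ∫ τ in (0 : ℝ)..t, (NormedSpace.exp (τ • D.Ac)) i j

/-- Zero-order-hold state matrix for `N` steps over a horizon of length `T`. -/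
def Ad (D : SystemData nx nu nG N) (T : ℝ) : Matrix (Fin nx) (Fin nx) ℝ :=
  NormedSpace.exp ((T / N) • D.Ac)

/-- Zero-order-hold input matrix for `N` steps over a horizon of length `T`. -/
def Bd (D : SystemData nx nu nG N) (T : ℝ) : Matrix (Fin nx) (Fin nu) ℝ :=
  D.expIntegral (T / N) * D.Bc

/-- The state reached at time `ts` from `xs` under the constant control `us`. -/
def xinit (D : SystemData nx nu nG N) (ts : ℝ) : Vec nx :=
  mulE (NormedSpace.exp (ts • D.Ac)) D.xs + mulE (D.expIntegral ts * D.Bc) D.us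

/-- The one-phase relaxed problem over `[0, tf]`, with stage costs `l₀ i`. -/
def onePhase (D : SystemData nx nu nG N) : DiscProblem nx nu nG N where
  A := D.Ad D.tf
  B := D.Bd D.tf
  xinit := D.xs
  m := D.m
  cost := D.l₀
  offset := 0
  g := D.g
  G := D.G
  ρmin := D.ρmin
  ρmax := D.ρmax

/-- The second-phase relaxed problem over `[ts, tf]`, with stage costs `l(σ_i) (tf - ts) / N`
and the constant first-phase cost `ts l(ρmin)`. -/
def twoPhase (D : SystemData nx nu nG N) (ts : ℝ) : DiscProblem nx nu nG N where
  A := D.Ad (D.tf - ts)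
  B := D.Bd (D.tf - ts)
  xinit := D.xinit ts
  m := D.m
  cost := fun _ σ => D.l σ * ((D.tf - ts) / N)
  offset := ts * D.l D.ρmin
  g := D.g
  G := D.G
  ρmin := D.ρmin
  ρmax := D.ρmax

/-- The optimal value `m*` of `min m(x)` subject to `G(x) = 0`. -/
def mStar (D : SystemData nx nu nG N) : ℝ :=
  sInf (D.m '' {x | D.G x = 0})

/-- Standing conventions on the data. -/
structure Standing (D : SystemData nx nu nG N) : Prop where
  N_pos : 0 < N
  tf_pos : 0 < D.tf
  m_convex : ConvexOn ℝ univ D.m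
  g_convex : ConvexOn ℝ univ D.g
  g_us : D.g D.us = D.ρmin

/-- The long-horizon assumption, with the time `tb` as witness. -/
structure LongHorizonAssumption (D : SystemData nx nu nG N) (tb : ℝ) : Prop where
  onePhase_regular : D.onePhase.RegularData
  onePhase_longHorizon : D.onePhase.LongHorizon
  tb_pos : 0 < tb
  tb_lt : tb < D.tf
  value_gt : D.mStar + D.tf * D.l D.ρmin < (D.twoPhase tb).value
  regular : ∀ ts ∈ Icc 0 tb, (D.twoPhase ts).RegularData
  controllable : ∀ ts ∈ Icc 0 tb, (D.twoPhase ts).Controllable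
  fullRowRank : ∀ ts ∈ Icc 0 tb, (D.twoPhase ts).FullRowRank
  slater : ∀ ts ∈ Icc 0 tb, (D.twoPhase ts).Slater

end SystemData

/-! ### Perturbation of the eigenvalues in the Jordan form -/

section Perturbation

variable {n : ℕ}

/-- A Jordan matrix: zero off the diagonal and the superdiagonal; a superdiagonal entry is `0`
(between two blocks) or `1` (inside a block, where the diagonal is constant). -/
def IsJordanMatrix (J : Matrix (Fin n) (Fin n) ℂ) : Prop :=
  (∀ i j : Fin n, i ≠ j → (i : ℕ) + 1 ≠ (j : ℕ) → J i j = 0) ∧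
  (∀ i j : Fin n, (i : ℕ) + 1 = (j : ℕ) → J i j = 0 ∨ (J i j = 1 ∧ J i i = J j j))

/-- `A = Q⁻¹ J Q` is a Jordan form of the real matrix `A` over `ℂ`. -/
def IsJordanForm (A : Matrix (Fin n) (Fin n) ℝ) (Q J : Matrix (Fin n) (Fin n) ℂ) : Prop :=
  IsUnit Q ∧ IsJordanMatrix J ∧ A.map Complex.ofReal = Q⁻¹ * J * Q

/-- The set of distinct (complex) eigenvalues of the real matrix `A`. -/
def eigs (A : Matrix (Fin n) (Fin n) ℝ) : Finset ℂ :=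
  (A.map Complex.ofReal).charpoly.roots.toFinset

/-- The perturbation vectors `q ∈ ℝᵈ`, one real number for each of the `d` distinct eigenvalues,
that shift complex conjugate eigenvalues by the same amount, so that the perturbed matrix is
again real. If all eigenvalues of `A` are real this is all of `ℝᵈ`. -/
def shifts (A : Matrix (Fin n) (Fin n) ℝ) : Submodule ℝ (EuclideanSpace ℝ (eigs A)) where
  carrier := {q | ∀ a b : eigs A, (b : ℂ) = conj (a : ℂ) → q a = q b}
  add_mem' := fun {p q} hp hq a b h => by
    simp only [PiLp.add_apply]
    rw [hp a b h, hq a b h]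
  zero_mem' := fun a b _ => by simp
  smul_mem' := fun c q hq a b h => by
    simp only [PiLp.smul_apply]
    rw [hq a b h]

open Classical in
/-- The shift that `q` prescribes for the eigenvalue `z`. -/
def shiftOf {A : Matrix (Fin n) (Fin n) ℝ} (q : shifts A) (z : ℂ) : ℝ :=
  if h : z ∈ eigs A then (q : EuclideanSpace ℝ (eigs A)) ⟨z, h⟩ else 0

/-- The real matrix `A'` is the perturbation `Q⁻¹ J' Q` of `A = Q⁻¹ J Q` by `q`, where `J'`
arises from `J` by shifting each eigenvalue `z` on the diagonal to `z + q_z`. -/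
def IsPerturbation {A : Matrix (Fin n) (Fin n) ℝ} (Q J : Matrix (Fin n) (Fin n) ℂ)
    (q : shifts A) (A' : Matrix (Fin n) (Fin n) ℝ) : Prop :=
  A'.map Complex.ofReal =
    Q⁻¹ * (J + Matrix.diagonal fun i => ((shiftOf q (J i i) : ℝ) : ℂ)) * Q

/-- The uniform distribution on the ball of radius `r` around `0` in the space of perturbation
vectors (normalized Haar measure of the finite-dimensional real space `shifts A`). -/
def uniformBall (A : Matrix (Fin n) (Fin n) ℝ) (r : ℝ) : Measure (shifts A) :=
  ProbabilityTheory.cond (Measure.addHaar : Measure (shifts A)) (Metric.ball 0 r)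

end Perturbation

end LCvx

end

/-! Write `b` for `D.mStar + D.tf * D.l D.ρmin`. The optimal value is continuous in the switching
time, is at most `b` at time `0` and exceeds `b` at `tb`. Hence some time has value strictly between
`b` and `b + η` (`exists_switch`). For small `η` the upper bound forces every slack and the terminal
cost to be almost minimal, since `l` grows with slope at least `L` (`near_minimal`). Both bounds are
open conditions on optimal controls, so by compactness and Slater's condition they survive small
perturbations of the dynamics (`Tame.eventually_optimal`).

The strict lower bound limits the violations. A control with `g (u i) < ρmin` can be varied freely
by small amounts. If `nx` such controls steer the end point in every direction, one can move it
towards any admissible target while lowering the slacks. Convexity then makes the optimal value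
equal to `b`, a contradiction (`Tame.minimal_of_steer`).

It remains that for almost every shift any `nx` of the blocks `A' ^ e * B`, `e < N`, span
(`ae_spanning`). Spanning is certified by a determinant that is polynomial along lines of shifts, so
one nonvanishing value, even at a complex shift, suffices. A complex shift moves the eigenvalues to
`I * μ j` with `μ j > 0`, keeping distinct ones distinct (`eq_zero_of_vecMul_powers`). By Descartes'
rule of signs any `n` powers then span all polynomials modulo the characteristic polynomial. The old
matrix is a polynomial in the new one, so controllability finishes the argument. -/

noncomputable section

namespace LCvx

open Filter Topology

/-! ### Matrices acting on Euclidean vectors -/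

section MulE

variable {j k n : ℕ}

lemma mulE_add (A : Matrix (Fin k) (Fin n) ℝ) (x y : Vec n) :
    mulE A (x + y) = mulE A x + mulE A y := by
  simp [mulE, Matrix.mulVec_add]

lemma mulE_smul (A : Matrix (Fin k) (Fin n) ℝ) (c : ℝ) (x : Vec n) :
    mulE A (c • x) = c • mulE A x := by
  simp [mulE, Matrix.mulVec_smul]

@[simp] lemma mulE_zero (A : Matrix (Fin k) (Fin n) ℝ) : mulE A 0 = 0 := by
  simp [mulE]

@[simp] lemma zero_mulE (x : Vec n) : mulE (0 : Matrix (Fin k) (Fin n) ℝ) x = 0 := by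
  simp [mulE]

@[simp] lemma one_mulE (x : Vec n) : mulE (1 : Matrix (Fin n) (Fin n) ℝ) x = x := by
  simp [mulE]

lemma mul_mulE (A : Matrix (Fin j) (Fin k) ℝ) (B : Matrix (Fin k) (Fin n) ℝ) (x : Vec n) :
    mulE (A * B) x = mulE A (mulE B x) := by
  simp [mulE]

/-- `mulE A` as a linear map. -/
def mulELin (A : Matrix (Fin k) (Fin n) ℝ) : Vec n →ₗ[ℝ] Vec k where
  toFun := mulE A
  map_add' := mulE_add A
  map_smul' := mulE_smul A

lemma mulE_sum {ι : Type*} (A : Matrix (Fin k) (Fin n) ℝ) (s : Finset ι) (f : ι → Vec n) :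
    mulE A (∑ i ∈ s, f i) = ∑ i ∈ s, mulE A (f i) :=
  map_sum (mulELin A) f s

@[fun_prop]
lemma Continuous.mulE {X : Type*} [TopologicalSpace X] {A : X → Matrix (Fin k) (Fin n) ℝ}
    {x : X → Vec n} (hA : Continuous A) (hx : Continuous x) :
    Continuous fun t => LCvx.mulE (A t) (x t) := by
  unfold LCvx.mulE
  exact (PiLp.continuous_toLp 2 _).comp
    (hA.matrix_mulVec ((PiLp.continuous_ofLp 2 _).comp hx))

end MulE

/-! ### Reduction of the discrete problem to its controls -/

section Steer

variable {nx nu N : ℕ}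

/-- Contribution of the control `u` to the end point. -/
def steer (A : Matrix (Fin nx) (Fin nx) ℝ) (B : Matrix (Fin nx) (Fin nu) ℝ)
    (u : Fin N → Vec nu) : Vec nx :=
  ∑ i : Fin N, mulE (A ^ (N - 1 - (i : ℕ)) * B) (u i)

variable (A : Matrix (Fin nx) (Fin nx) ℝ) (B : Matrix (Fin nx) (Fin nu) ℝ)

lemma steer_add (u v : Fin N → Vec nu) : steer A B (u + v) = steer A B u + steer A B v := by
  simp [steer, mulE_add, Finset.sum_add_distrib]

lemma steer_smul (c : ℝ) (u : Fin N → Vec nu) : steer A B (c • u) = c • steer A B u := by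
  simp [steer, mulE_smul, Finset.smul_sum]

/-- `steer A B` as a linear map. -/
def steerLin : (Fin N → Vec nu) →ₗ[ℝ] Vec nx where
  toFun := steer A B
  map_add' := steer_add A B
  map_smul' := steer_smul A B

@[simp] lemma steerLin_apply (u : Fin N → Vec nu) : steerLin A B u = steer A B u := rfl

@[fun_prop]
lemma Continuous.steer {X : Type*} [TopologicalSpace X] {A : X → Matrix (Fin nx) (Fin nx) ℝ}
    {B : X → Matrix (Fin nx) (Fin nu) ℝ} {u : X → Fin N → Vec nu}
    (hA : Continuous A) (hB : Continuous B) (hu : Continuous u) :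
    Continuous fun t => LCvx.steer (A t) (B t) (u t) := by
  unfold LCvx.steer
  refine continuous_finsetSum _ fun i _ => ?_
  exact Continuous.mulE ((hA.pow _).matrix_mul hB) ((continuous_apply i).comp hu)

end Steer

namespace DiscProblem

variable {nx nu nG N : ℕ} (P : DiscProblem nx nu nG N)

lemma trajectory_eq (u : Fin N → Vec nu) (k : Fin (N + 1)) :
    P.trajectory u k = mulE (P.A ^ (k : ℕ)) P.xinit +
      ∑ i : Fin N, if (i : ℕ) < k then mulE (P.A ^ ((k : ℕ) - 1 - i) * P.B) (u i) else 0 := by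
  induction k using Fin.induction with
  | zero => simp [trajectory]
  | succ k ih =>
    have h1 : P.trajectory u k.succ =
        mulE P.A (P.trajectory u k.castSucc) + mulE P.B (u k) := by
      simp [trajectory]
    rw [h1, ih, mulE_add, mulE_sum, add_assoc]
    congr 1
    · simp [pow_succ', mul_mulE]
    · have h2 : mulE P.B (u k) = ∑ i : Fin N, if i = k then mulE P.B (u i) else 0 := by simp
      rw [h2, ← Finset.sum_add_distrib]
      refine Finset.sum_congr rfl fun i _ => ?_
      rcases lt_trichotomy (i : ℕ) (k : ℕ) with h | h | h
      · have h3 : i ≠ k := fun h' => by simp [h'] at h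
        have h4 : (k : ℕ) - i = (k - 1 - i) + 1 := by omega
        simp [h, h3, Nat.lt_succ_of_lt h, h4, pow_succ', mul_mulE]
      · have h3 : i = k := Fin.ext h
        simp [h3]
      · have h3 : i ≠ k := fun h' => by simp [h'] at h
        have h4 : ¬ ((i : ℕ) < (k : ℕ) + 1) := by omega
        simp [h3, h.le.not_gt, h4]

lemma endpoint_eq (u : Fin N → Vec nu) :
    P.endpoint u = mulE (P.A ^ N) P.xinit + steer P.A P.B u := by
  simp [endpoint, trajectory_eq, steer]

lemma eq_trajectory_iff (x : Fin (N + 1) → Vec nx) (u : Fin N → Vec nu) :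
    x = P.trajectory u ↔ x 0 = P.xinit ∧
      ∀ i : Fin N, x i.succ = mulE P.A (x i.castSucc) + mulE P.B (u i) := by
  constructor
  · rintro rfl
    exact ⟨by simp [trajectory], fun i => by simp [trajectory]⟩
  · rintro ⟨h0, h⟩
    funext k
    induction k using Fin.induction with
    | zero => simp [h0, trajectory]
    | succ k ih => rw [h k, ih]; simp [trajectory]

/-- Feasibility expressed through the controls alone. -/
def CtrlFeasible (u : Fin N → Vec nu) (σ : Fin N → ℝ) : Prop :=
  (∀ i, (u i, σ i) ∈ P.V) ∧ P.G (P.endpoint u) = 0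

/-- The objective expressed through the controls alone. -/
def ctrlObjective (u : Fin N → Vec nu) (σ : Fin N → ℝ) : ℝ :=
  P.m (P.endpoint u) + ∑ i, P.cost i (σ i) + P.offset

lemma H_eq_zero_iff (x : Fin (N + 1) → Vec nx) (u : Fin N → Vec nu) (σ : Fin N → ℝ) :
    P.H (x, u, σ) = 0 ↔ x = P.trajectory u ∧ P.G (P.endpoint u) = 0 := by
  constructor
  · intro h
    simp only [H, Prod.mk_eq_zero, sub_eq_zero, funext_iff, Pi.zero_apply] at h
    have hx := (P.eq_trajectory_iff x u).2 ⟨h.1, h.2.1⟩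
    exact ⟨hx, by rw [endpoint, ← hx]; exact h.2.2⟩
  · rintro ⟨hx, hG⟩
    have h := (P.eq_trajectory_iff x u).1 hx
    simp only [H, Prod.mk_eq_zero, sub_eq_zero, funext_iff, Pi.zero_apply]
    exact ⟨h.1, h.2, by rw [hx]; exact hG⟩

lemma mem_feasible_iff (x : Fin (N + 1) → Vec nx) (u : Fin N → Vec nu) (σ : Fin N → ℝ) :
    (x, u, σ) ∈ P.feasible ↔ x = P.trajectory u ∧ P.CtrlFeasible u σ := by
  simp only [feasible, mem_ofPred_eq, H_eq_zero_iff, CtrlFeasible, Vtilde]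
  tauto

lemma objective_trajectory (u : Fin N → Vec nu) (σ : Fin N → ℝ) :
    P.objective (P.trajectory u, u, σ) = P.ctrlObjective u σ := rfl

lemma isOptimal_iff (x : Fin (N + 1) → Vec nx) (u : Fin N → Vec nu) (σ : Fin N → ℝ) :
    P.IsOptimal (x, u, σ) ↔ x = P.trajectory u ∧ P.CtrlFeasible u σ ∧
      ∀ u' σ', P.CtrlFeasible u' σ' → P.ctrlObjective u σ ≤ P.ctrlObjective u' σ' := by
  constructor
  · rintro ⟨hf, ho⟩
    obtain ⟨rfl, hc⟩ := (P.mem_feasible_iff x u σ).1 hf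
    exact ⟨rfl, hc, fun u' σ' h => ho _ ((P.mem_feasible_iff _ u' σ').2 ⟨rfl, h⟩)⟩
  · rintro ⟨rfl, hc, ho⟩
    refine ⟨(P.mem_feasible_iff _ u σ).2 ⟨rfl, hc⟩, ?_⟩
    rintro ⟨x', u', σ'⟩ h
    obtain ⟨rfl, hc'⟩ := (P.mem_feasible_iff x' u' σ').1 h
    exact ho u' σ' hc'

lemma value_eq {x : Fin (N + 1) → Vec nx} {u : Fin N → Vec nu} {σ : Fin N → ℝ}
    (h : P.IsOptimal (x, u, σ)) : P.value = P.ctrlObjective u σ := by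
  have hx := ((P.isOptimal_iff x u σ).1 h).1
  have hm : IsLeast (P.objective '' P.feasible) (P.objective (x, u, σ)) :=
    ⟨mem_image_of_mem _ h.1, by rintro _ ⟨w, hw, rfl⟩; exact h.2 w hw⟩
  rw [value, hm.csInf_eq, hx, objective_trajectory]

/-- The linear part of the equality constraints. -/
def HLin : DecVar nx nu N →ₗ[ℝ] Vec nx × (Fin N → Vec nx) × Vec nG where
  toFun z := (z.1 0, fun i => z.1 i.succ - (mulE P.A (z.1 i.castSucc) + mulE P.B (z.2.1 i)),
    P.G.linear (z.1 (Fin.last N)))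
  map_add' z w := by
    ext1
    · simp
    · ext1
      · funext i
        simp only [Prod.fst_add, Prod.snd_add, Pi.add_apply, mulE_add]
        abel
      · simp
  map_smul' c z := by
    ext1
    · simp
    · ext1
      · funext i
        simp [mulE_smul, smul_sub]
      · simp

lemma fderiv_H (z : DecVar nx nu N) (w : DecVar nx nu N) : fderiv ℝ P.H z w = P.HLin w := by
  have hz : P.H = fun z => P.HLin.toContinuousLinearMap z + (-P.xinit, (0 : Fin N → Vec nx), P.G 0) := by
    funext z
    ext1
    · simp [H, HLin, sub_eq_add_neg]
    · ext1
      · simp [H, HLin]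
      · simp only [H, HLin]
        have := congrFun P.G.decomp (z.1 (Fin.last N))
        simpa using this
  rw [hz, fderiv_add_const, ContinuousLinearMap.fderiv]
  rfl

/-- A preimage of `(0, 0, y)` under the Jacobian is a trajectory of the dynamics started at zero,
whose end point is `steer` of its control. -/
lemma FullRowRank.surjective_steer {P : DiscProblem nx nu nG N} (h : P.FullRowRank) :
    Function.Surjective (P.G.linear ∘ₗ steerLin (N := N) P.A P.B) := by
  intro y
  obtain ⟨⟨x, u, σ⟩, hw⟩ := h 0 (0, 0, y)
  rw [fderiv_H] at hw
  simp only [HLin, LinearMap.coe_mk, AddHom.coe_mk, Prod.mk.injEq, funext_iff, Pi.zero_apply,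
    sub_eq_zero] at hw
  let P' : DiscProblem nx nu nG N := { P with xinit := 0 }
  have hx := (P'.eq_trajectory_iff x u).2 ⟨hw.1, hw.2.1⟩
  have he := P'.endpoint_eq u
  rw [endpoint, ← hx] at he
  refine ⟨u, ?_⟩
  rw [← hw.2.2, he]
  simp [P']

/-- A strictly feasible control. -/
lemma Slater.exists_strict {P : DiscProblem nx nu nG N} (h : P.Slater) :
    ∃ (u : Fin N → Vec nu) (σ : Fin N → ℝ), (∀ i, P.ρmin < σ i ∧ σ i < P.ρmax ∧ P.g (u i) < σ i) ∧ P.G (P.endpoint u) = 0 := by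
  obtain ⟨⟨x, u, σ⟩, hz, hH⟩ := h
  refine ⟨u, σ, ?_, ((P.H_eq_zero_iff x u σ).1 hH).2⟩
  -- Shifting all slacks up and down by `r / 2` stays inside the inequality set, so the unshifted
  -- inequalities are strict.
  have hc : Continuous fun s : ℝ => ((x, u, fun i => σ i + s) : DecVar nx nu N) := by fun_prop
  have hc0 : Tendsto (fun s : ℝ => ((x, u, fun i => σ i + s) : DecVar nx nu N)) (𝓝 0)
      (𝓝 (x, u, σ)) := by
    have := hc.tendsto 0
    simpa using this
  have hev : ∀ᶠ s : ℝ in 𝓝 0, ((x, u, fun i => σ i + s) : DecVar nx nu N) ∈ P.Vtilde :=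
    hc0 (mem_interior_iff_mem_nhds.1 hz)
  obtain ⟨r, hr, hball⟩ := Metric.eventually_nhds_iff.1 hev
  intro i
  have h1 := hball (y := r / 2) (by simp [abs_of_pos hr]; linarith) i
  have h2 := hball (y := -(r / 2)) (by simp [abs_of_pos hr]; linarith) i
  simp only [V, mem_ofPred_eq] at h1 h2
  exact ⟨by linarith, by linarith, by linarith⟩

end DiscProblem

/-! ### Stability of optimal solutions under changes of the parameters -/

/-- Parameters `(A, B, xinit, c, o)`: dynamics, initial state, weight of the stage cost, offset. -/
abbrev Params (nx nu : ℕ) : Type :=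
  Matrix (Fin nx) (Fin nx) ℝ × Matrix (Fin nx) (Fin nu) ℝ × Vec nx × ℝ × ℝ

/-- A control `(u, σ)`. -/
abbrev Ctrl (nu N : ℕ) : Type := (Fin N → Vec nu) × (Fin N → ℝ)

namespace SystemData

variable {nx nu nG N : ℕ} (D : SystemData nx nu nG N)

/-- The discrete problem with the cost and constraint functions of `D` and the parameters `p`. -/
def prob (p : Params nx nu) : DiscProblem nx nu nG N where
  A := p.1
  B := p.2.1
  xinit := p.2.2.1
  m := D.m
  cost := fun _ σ => D.l σ * p.2.2.2.1
  offset := p.2.2.2.2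
  g := D.g
  G := D.G
  ρmin := D.ρmin
  ρmax := D.ρmax

/-- The end point as a function of parameters and control. -/
def endp (N : ℕ) (p : Params nx nu) (u : Fin N → Vec nu) : Vec nx :=
  mulE (p.1 ^ N) p.2.2.1 + steer p.1 p.2.1 u

lemma endpoint_prob (p : Params nx nu) (u : Fin N → Vec nu) :
    (D.prob p).endpoint u = endp N p u := (D.prob p).endpoint_eq u

@[fun_prop]
lemma Continuous.endp {X : Type*} [TopologicalSpace X] {p : X → Params nx nu}
    {u : X → Fin N → Vec nu} (hp : Continuous p) (hu : Continuous u) :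
    Continuous fun t => SystemData.endp N (p t) (u t) := by
  unfold SystemData.endp
  exact (Continuous.mulE (hp.fst.pow N) hp.snd.snd.fst).add (Continuous.steer hp.fst hp.snd.fst hu)

/-- A continuous extension of the objective to all controls. -/
def extObjective (p : Params nx nu) (w : Ctrl nu N) : ℝ :=
  D.m (endp N p w.1) + ∑ i, D.l (max D.ρmin (w.2 i)) * p.2.2.2.1 + p.2.2.2.2

/-- Continuity and compactness properties of the data. -/
structure Tame : Prop where
  g_convex : ConvexOn ℝ univ D.g
  g_cont : Continuous D.g
  m_cont : Continuous D.m
  l_cont : ContinuousOn D.l (Ici D.ρmin)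
  compact : IsCompact {u | D.g u ≤ D.ρmax}

variable {D}

lemma ctrlObjective_eq_extObjective {p : Params nx nu} {u : Fin N → Vec nu} {σ : Fin N → ℝ}
    (h : (D.prob p).CtrlFeasible u σ) :
    (D.prob p).ctrlObjective u σ = D.extObjective p (u, σ) := by
  have hσ : ∀ i, max D.ρmin (σ i) = σ i := fun i => max_eq_right (h.1 i).1
  simp only [DiscProblem.ctrlObjective, extObjective, endpoint_prob, hσ]
  rfl

lemma Tame.continuous_extObjective (hT : D.Tame) :
    Continuous fun x : Params nx nu × Ctrl nu N => D.extObjective x.1 x.2 := by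
  unfold extObjective
  have hl : Continuous fun s : ℝ => D.l (max D.ρmin s) :=
    hT.l_cont.comp_continuous (by fun_prop) fun s => mem_Ici.2 (le_max_left _ _)
  have hm := hT.m_cont
  refine ((hm.comp (Continuous.endp (by fun_prop) (by fun_prop))).add ?_).add (by fun_prop)
  refine continuous_finsetSum _ fun i _ => ?_
  exact (hl.comp (by fun_prop)).mul (by fun_prop)

lemma Tame.isClosed_feasible (hT : D.Tame) :
    IsClosed {x : Params nx nu × Ctrl nu N | (D.prob x.1).CtrlFeasible x.2.1 x.2.2} := by
  have hG : Continuous D.G := D.G.continuous_of_finiteDimensional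
  have hg := hT.g_cont
  simp only [DiscProblem.CtrlFeasible, DiscProblem.V, endpoint_prob, ofPred_and,
    ofPred_forall]
  refine IsClosed.inter (isClosed_iInter fun i => ?_) ?_
  · refine IsClosed.inter (isClosed_le continuous_const (by fun_prop))
      (IsClosed.inter (isClosed_le (by fun_prop) continuous_const)
        (isClosed_le (hg.comp (by fun_prop)) (by fun_prop)))
  · exact isClosed_eq (hG.comp (Continuous.endp (by fun_prop) (by fun_prop))) continuous_const

/-- The compact set of controls that contains all feasible ones. -/
def ctrlBox (D : SystemData nx nu nG N) : Set (Ctrl nu N) :=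
  (univ.pi fun _ => {u | D.g u ≤ D.ρmax}) ×ˢ (univ.pi fun _ => Icc D.ρmin D.ρmax)

lemma Tame.isCompact_ctrlBox (hT : D.Tame) : IsCompact D.ctrlBox :=
  (isCompact_univ_pi fun _ => hT.compact).prod (isCompact_univ_pi fun _ => isCompact_Icc)

lemma mem_ctrlBox {p : Params nx nu} {u : Fin N → Vec nu} {σ : Fin N → ℝ}
    (h : (D.prob p).CtrlFeasible u σ) : (u, σ) ∈ D.ctrlBox :=
  ⟨fun i _ => (h.1 i).2.2.trans (h.1 i).2.1, fun i _ => ⟨(h.1 i).1, (h.1 i).2.1⟩⟩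

lemma Tame.exists_isOptimal (hT : D.Tame) {p : Params nx nu} {u₀ : Fin N → Vec nu}
    {σ₀ : Fin N → ℝ} (h : (D.prob p).CtrlFeasible u₀ σ₀) :
    ∃ x u σ, (D.prob p).IsOptimal (x, u, σ) := by
  have hcl : IsClosed {w : Ctrl nu N | (D.prob p).CtrlFeasible w.1 w.2} :=
    hT.isClosed_feasible.preimage (f := fun w => (p, w)) (by fun_prop)
  have hK : IsCompact {w : Ctrl nu N | (D.prob p).CtrlFeasible w.1 w.2} :=
    hT.isCompact_ctrlBox.of_isClosed_subset hcl fun w hw => mem_ctrlBox hw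
  obtain ⟨w, hw, hmin⟩ := hK.exists_isMinOn ⟨(u₀, σ₀), h⟩
    (f := fun w => D.extObjective p w)
    (hT.continuous_extObjective.comp (f := fun w : Ctrl nu N => (p, w))
      (by fun_prop)).continuousOn
  refine ⟨_, w.1, w.2, ((D.prob p).isOptimal_iff _ _ _).2 ⟨rfl, hw, fun u' σ' h' => ?_⟩⟩
  rw [ctrlObjective_eq_extObjective hw, ctrlObjective_eq_extObjective h']
  exact hmin (a := (u', σ')) h'

/-- Near a strictly feasible control there are feasible controls for all nearby parameters. -/
lemma Tame.eventually_feasible_of_strict (hT : D.Tame) {p₀ : Params nx nu}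
    (hsurj : Function.Surjective (D.G.linear ∘ₗ steerLin (N := N) p₀.1 p₀.2.1))
    {w : Ctrl nu N}
    (hw : ∀ i, D.ρmin < w.2 i ∧ w.2 i < D.ρmax ∧ D.g (w.1 i) < w.2 i)
    (hG : D.G (endp N p₀ w.1) = 0) {O : Set (Params nx nu × Ctrl nu N)} (hO : O ∈ 𝓝 (p₀, w)) :
    ∀ᶠ p in 𝓝 p₀, ∃ w' : Ctrl nu N, (D.prob p).CtrlFeasible w'.1 w'.2 ∧ (p, w') ∈ O := by
  obtain ⟨R, hR⟩ := LinearMap.exists_rightInverse_of_surjective _ (LinearMap.range_eq_top.2 hsurj)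
  have hRc : Continuous R := R.continuous_of_finiteDimensional
  have hGc : Continuous D.G := D.G.continuous_of_finiteDimensional
  have hGl : Continuous D.G.linear := D.G.linear.continuous_of_finiteDimensional
  -- Correcting the control by `R y` changes the terminal residual by `T p y`. As `T p₀ = 1`, the
  -- operator `T p` is invertible nearby and the residual can be cancelled by a small `y`.
  let T : Params nx nu → (Vec nG →L[ℝ] Vec nG) := fun p =>
    (D.G.linear ∘ₗ steerLin (N := N) p.1 p.2.1 ∘ₗ R).toContinuousLinearMap
  have hTc : Continuous T := by
    refine continuous_clm_apply.2 fun y => ?_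
    exact hGl.comp (Continuous.steer (by fun_prop) (by fun_prop) continuous_const)
  have hT0 : T p₀ = 1 := by
    ext1 y
    exact LinearMap.congr_fun hR y
  let y : Params nx nu → Vec nG := fun p => -(Ring.inverse (T p) (D.G (endp N p w.1)))
  have hinv : ContinuousAt (fun p => Ring.inverse (T p)) p₀ := by
    have h1 : ContinuousAt Ring.inverse (T p₀) := by
      rw [hT0]; exact NormedRing.inverse_continuousAt 1
    exact h1.comp hTc.continuousAt
  have hy : ContinuousAt y p₀ := by
    refine (hinv.clm_apply (ContinuousAt.comp hGc.continuousAt ?_)).neg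
    exact (Continuous.endp continuous_id continuous_const).continuousAt
  have hy0 : y p₀ = 0 := by simp [y, hG]
  let w' : Params nx nu → Ctrl nu N := fun p => (w.1 + R (y p), w.2)
  have hw' : ContinuousAt (fun p => (p, w' p)) p₀ := by
    refine continuousAt_id.prodMk ((continuousAt_const.add ?_).prodMk continuousAt_const)
    exact ContinuousAt.comp hRc.continuousAt hy
  have hw'0 : w' p₀ = w := by simp [w', hy0]
  have hunit : ∀ᶠ p in 𝓝 p₀, IsUnit (T p) := by
    have : {t : Vec nG →L[ℝ] Vec nG | IsUnit t} ∈ 𝓝 (T p₀) := by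
      rw [hT0]; exact Units.nhds 1
    exact hTc.continuousAt this
  have hOe : ∀ᶠ p in 𝓝 p₀, (p, w' p) ∈ O := by
    refine hw'.eventually_mem ?_
    rwa [hw'0]
  have hS : {x : Params nx nu × Ctrl nu N |
      ∀ i, D.ρmin < x.2.2 i ∧ x.2.2 i < D.ρmax ∧ D.g (x.2.1 i) < x.2.2 i} ∈ 𝓝 (p₀, w) := by
    refine IsOpen.mem_nhds ?_ hw
    have hg := hT.g_cont
    simp only [ofPred_forall, ofPred_and]
    refine isOpen_iInter_of_finite fun i => ?_
    exact (isOpen_lt continuous_const (by fun_prop)).inter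
      ((isOpen_lt (by fun_prop) continuous_const).inter
        (isOpen_lt (hg.comp (by fun_prop)) (by fun_prop)))
  have hSe : ∀ᶠ p in 𝓝 p₀, (p, w' p) ∈ {x : Params nx nu × Ctrl nu N |
      ∀ i, D.ρmin < x.2.2 i ∧ x.2.2 i < D.ρmax ∧ D.g (x.2.1 i) < x.2.2 i} := by
    refine hw'.eventually_mem ?_
    rwa [hw'0]
  filter_upwards [hunit, hOe, hSe] with p hp1 hp2 hp3
  refine ⟨w' p, ⟨fun i => ⟨(hp3 i).1.le, (hp3 i).2.1.le, (hp3 i).2.2.le⟩, ?_⟩, hp2⟩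
  rw [endpoint_prob]
  have h1 : endp N p (w' p).1 = steer p.1 p.2.1 (R (y p)) +ᵥ endp N p w.1 := by
    simp only [endp, w', steer_add, vadd_eq_add]
    abel
  have h2 : D.G.linear (steer p.1 p.2.1 (R (y p))) = T p (y p) := rfl
  have h3 : T p (Ring.inverse (T p) (D.G (endp N p w.1))) = D.G (endp N p w.1) := by
    have := Ring.mul_inverse_cancel _ hp1
    exact DFunLike.congr_fun this _
  change D.G _ = 0
  rw [h1, AffineMap.map_vadd, h2]
  simp only [y, map_neg, h3, vadd_eq_add, neg_add_cancel]

lemma endp_lineMap (p : Params nx nu) (u v : Fin N → Vec nu) (t : ℝ) :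
    endp N p ((1 - t) • u + t • v) = AffineMap.lineMap (endp N p u) (endp N p v) t := by
  simp only [endp, steer_add, steer_smul, AffineMap.lineMap_apply_module, smul_add]
  module

lemma Tame.g_combo (hT : D.Tame) (u v : Vec nu) {t : ℝ} (h0 : 0 ≤ t) (h1 : t ≤ 1) :
    D.g ((1 - t) • u + t • v) ≤ (1 - t) * D.g u + t * D.g v := by
  have := hT.g_convex.2 (mem_univ u) (mem_univ v) (sub_nonneg.2 h1) h0 (by ring)
  simpa using this

/-- Near a feasible control there are feasible controls for all nearby parameters. -/
lemma Tame.eventually_feasible (hT : D.Tame) {p₀ : Params nx nu}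
    (hrank : (D.prob p₀).FullRowRank) (hsl : (D.prob p₀).Slater) {w : Ctrl nu N}
    (hw : (D.prob p₀).CtrlFeasible w.1 w.2) {O : Set (Params nx nu × Ctrl nu N)}
    (hO : O ∈ 𝓝 (p₀, w)) :
    ∀ᶠ p in 𝓝 p₀, ∃ w' : Ctrl nu N, (D.prob p).CtrlFeasible w'.1 w'.2 ∧ (p, w') ∈ O := by
  obtain ⟨us, σs, hs, hsG⟩ := hsl.exists_strict
  change ∀ i, D.ρmin < σs i ∧ σs i < D.ρmax ∧ D.g (us i) < σs i at hs
  rw [endpoint_prob] at hsG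
  have hwG := hw.2
  rw [endpoint_prob] at hwG
  -- On the segment from `w` to a Slater point, every point with `t > 0` is strictly feasible, and
  -- small `t` stays in the neighbourhood.
  let c : ℝ → Ctrl nu N := fun t => ((1 - t) • w.1 + t • us, (1 - t) • w.2 + t • σs)
  have hc : Continuous fun t => (p₀, c t) := by fun_prop
  have hc0 : (p₀, c 0) = (p₀, w) := by simp [c]
  have hev : ∀ᶠ t in 𝓝[>] (0 : ℝ), (p₀, c t) ∈ interior O := by
    refine (hc.continuousAt.eventually_mem ?_).filter_mono nhdsWithin_le_nhds
    rw [hc0]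
    exact interior_mem_nhds.2 hO
  obtain ⟨t, htO, ht0, ht1⟩ :=
    (hev.and (Ioo_mem_nhdsGT (zero_lt_one' ℝ))).exists
  refine hT.eventually_feasible_of_strict (w := c t) hrank.surjective_steer ?_ ?_
    (mem_interior_iff_mem_nhds.1 htO)
  · intro i
    obtain ⟨h1, h2, h3⟩ := hw.1 i
    change D.ρmin ≤ w.2 i at h1
    change w.2 i ≤ D.ρmax at h2
    change D.g (w.1 i) ≤ w.2 i at h3
    obtain ⟨h4, h5, h6⟩ := hs i
    have ht2 : 0 ≤ 1 - t := by linarith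
    have h7 := hT.g_combo (w.1 i) (us i) ht0.le ht1.le
    simp only [c, Pi.add_apply, Pi.smul_apply, smul_eq_mul]
    refine ⟨by nlinarith, by nlinarith, h7.trans_lt (by nlinarith)⟩
  · simp only [c, endp_lineMap]
    change D.G _ = 0 at hwG
    change D.G _ = 0 at hsG
    rw [AffineMap.apply_lineMap, hwG, hsG, AffineMap.lineMap_same_apply]

/-- If all optimal controls of the problem with parameters `p₀` lie in the open set `W`, so do
those for nearby parameters, and optimal solutions exist. -/
theorem Tame.eventually_optimal (hT : D.Tame) {p₀ : Params nx nu}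
    (hrank : (D.prob p₀).FullRowRank) (hsl : (D.prob p₀).Slater)
    {W : Set (Params nx nu × Ctrl nu N)} (hW : IsOpen W)
    (hopt : ∀ x u σ, (D.prob p₀).IsOptimal (x, u, σ) → (p₀, (u, σ)) ∈ W) :
    ∀ᶠ p in 𝓝 p₀, (∃ x u σ, (D.prob p).IsOptimal (x, u, σ)) ∧
      ∀ x u σ, (D.prob p).IsOptimal (x, u, σ) → (p, (u, σ)) ∈ W := by
  obtain ⟨us, σs, hs, hsG⟩ := hsl.exists_strict
  obtain ⟨x₀, u₀, σ₀, h₀⟩ := hT.exists_isOptimal (p := p₀) (u₀ := us) (σ₀ := σs)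
    ⟨fun i => ⟨(hs i).1.le, (hs i).2.1.le, (hs i).2.2.le⟩, hsG⟩
  obtain ⟨-, hf₀, hm₀⟩ := ((D.prob p₀).isOptimal_iff _ _ _).1 h₀
  have hcont := hT.continuous_extObjective
  -- Upper semicontinuity of the optimal value.
  have hex : ∀ κ > D.extObjective p₀ (u₀, σ₀), ∀ᶠ p in 𝓝 p₀, ∃ w' : Ctrl nu N,
      (D.prob p).CtrlFeasible w'.1 w'.2 ∧ D.extObjective p w' < κ := fun κ hκ =>
    hT.eventually_feasible hrank hsl (w := (u₀, σ₀)) hf₀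
      (O := {x | D.extObjective x.1 x.2 < κ})
      ((isOpen_lt hcont continuous_const).mem_nhds hκ)
  have hbox : ∀ᶠ p in 𝓝 p₀, ∀ w ∈ D.ctrlBox,
      (∃ x, (D.prob p).IsOptimal (x, w.1, w.2)) → (p, w) ∈ W := by
    -- By compactness a local statement at each `w` is enough: an optimal `w` lies in the open set
    -- `W`; a feasible suboptimal one is beaten nearby through `hex`; an infeasible one has only
    -- infeasible neighbours.
    refine hT.isCompact_ctrlBox.eventually_forall_of_forall_eventually fun w _ => ?_
    by_cases hwf : (D.prob p₀).CtrlFeasible w.1 w.2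
    · by_cases hwo : D.extObjective p₀ w ≤ D.extObjective p₀ (u₀, σ₀)
      · have hwW : (p₀, w) ∈ W := by
          refine hopt _ w.1 w.2 (((D.prob p₀).isOptimal_iff _ _ _).2
            ⟨rfl, hwf, fun u' σ' h' => ?_⟩)
          refine le_trans ?_ (hm₀ u' σ' h')
          rwa [ctrlObjective_eq_extObjective hwf, ctrlObjective_eq_extObjective hf₀]
        filter_upwards [hW.mem_nhds hwW] with z hz _ using hz
      · push Not at hwo
        obtain ⟨κ, hκ1, hκ2⟩ := exists_between hwo
        have h1 : ∀ᶠ z : Params nx nu × Ctrl nu N in 𝓝 (p₀, w), κ < D.extObjective z.1 z.2 :=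
          (isOpen_lt continuous_const hcont).mem_nhds hκ2
        have h2 : ∀ᶠ z : Params nx nu × Ctrl nu N in 𝓝 (p₀, w), ∃ w' : Ctrl nu N,
            (D.prob z.1).CtrlFeasible w'.1 w'.2 ∧ D.extObjective z.1 w' < κ :=
          (continuous_fst.tendsto (p₀, w)).eventually (hex κ hκ1)
        filter_upwards [h1, h2] with z hz1 hz2 ⟨x, hx⟩
        obtain ⟨w', hw'1, hw'2⟩ := hz2
        obtain ⟨-, hzf, hzm⟩ := ((D.prob z.1).isOptimal_iff _ _ _).1 hx
        have h3 := hzm w'.1 w'.2 hw'1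
        rw [ctrlObjective_eq_extObjective hzf, ctrlObjective_eq_extObjective hw'1] at h3
        exact absurd (hz1.trans_le h3) (not_lt.2 hw'2.le)
    · have : {x : Params nx nu × Ctrl nu N | (D.prob x.1).CtrlFeasible x.2.1 x.2.2}ᶜ ∈
          𝓝 (p₀, w) := hT.isClosed_feasible.isOpen_compl.mem_nhds hwf
      filter_upwards [this] with z hz ⟨x, hx⟩
      exact absurd (((D.prob z.1).isOptimal_iff _ _ _).1 hx).2.1 hz
  filter_upwards [hbox, hex _ (lt_add_one _)] with p hp1 hp2
  obtain ⟨w', hw'1, -⟩ := hp2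
  refine ⟨hT.exists_isOptimal hw'1, fun x u σ h => hp1 (u, σ) ?_ ⟨x, h⟩⟩
  exact mem_ctrlBox (((D.prob p).isOptimal_iff _ _ _).1 h).2.1

/-- The optimal value is continuous in the parameters. -/
theorem Tame.continuousAt_value (hT : D.Tame) {p₀ : Params nx nu}
    (hrank : (D.prob p₀).FullRowRank) (hsl : (D.prob p₀).Slater) :
    ContinuousAt (fun p => (D.prob p).value) p₀ := by
  have hval : ∀ p x u σ, (D.prob p).IsOptimal (x, u, σ) →
      (D.prob p).value = D.extObjective p (u, σ) := fun p x u σ h => by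
    rw [(D.prob p).value_eq h,
      ctrlObjective_eq_extObjective (((D.prob p).isOptimal_iff _ _ _).1 h).2.1]
  refine Metric.tendsto_nhds.2 fun e he => ?_
  have := hT.eventually_optimal hrank hsl
    (W := {x | dist (D.extObjective x.1 x.2) (D.prob p₀).value < e})
    (isOpen_lt (hT.continuous_extObjective.dist continuous_const) continuous_const)
    (fun x u σ h => by simp [hval p₀ x u σ h, he])
  filter_upwards [this] with p hp
  obtain ⟨⟨x, u, σ, h⟩, h2⟩ := hp
  rw [hval p x u σ h]
  exact h2 x u σ h

end SystemData

/-! ### Controls that violate the lower bound -/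

/-- A family of matrix products with trivial common left kernel steers to every state. -/
lemma exists_steer_eq {nx nu N : ℕ} (A : Matrix (Fin nx) (Fin nx) ℝ)
    (B : Matrix (Fin nx) (Fin nu) ℝ) (I : Set (Fin N))
    (hI : ∀ v : Fin nx → ℝ, (∀ i ∈ I, v ᵥ* (A ^ (N - 1 - (i : ℕ)) * B) = 0) → v = 0)
    (y : Vec nx) : ∃ w : Fin N → Vec nu, (∀ i ∉ I, w i = 0) ∧ steer A B w = y := by
  classical
  -- The projection onto controls supported in `I`.
  let M : (Fin N → Vec nu) →ₗ[ℝ] (Fin N → Vec nu) :=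
    LinearMap.pi fun i => if i ∈ I then LinearMap.proj i else 0
  have hM : ∀ w i, M w i = if i ∈ I then w i else 0 := fun w i => by
    by_cases h : i ∈ I <;> simp [M, h]
  have hr : LinearMap.range (steerLin A B ∘ₗ M) = ⊤ := by
    rw [← Submodule.orthogonal_eq_bot_iff, Submodule.eq_bot_iff]
    intro v hv
    rw [Submodule.mem_orthogonal] at hv
    suffices hz : WithLp.ofLp v = 0 by
      ext i; exact congrFun hz i
    refine hI _ fun i hi => ?_
    set C := A ^ (N - 1 - (i : ℕ)) * B with hC
    -- With this input the inner product of `v` and the end point is the squared length of `v ᵥ* C`.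
    let e : Vec nu := WithLp.toLp 2 (WithLp.ofLp v ᵥ* C)
    have h1 := hv _ ⟨Pi.single i e, rfl⟩
    have h2 : M (Pi.single i e) = Pi.single i e := by
      funext j
      rw [hM]
      by_cases hj : j = i
      · subst hj; simp [hi]
      · simp [hj]
    have h3 : steer A B (Pi.single i e : Fin N → Vec nu) = mulE C e := by
      rw [steer, Finset.sum_eq_single i]
      · simp [hC]
      · intro j _ hj; simp [hj]
      · simp
    rw [LinearMap.comp_apply, h2, steerLin_apply, h3] at h1
    have h4 : WithLp.ofLp v ⬝ᵥ (C *ᵥ (WithLp.ofLp v ᵥ* C)) = 0 := by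
      simpa [EuclideanSpace.inner_eq_star_dotProduct, mulE, e] using h1
    rwa [Matrix.dotProduct_mulVec, dotProduct_self_eq_zero] at h4
  obtain ⟨w, hw⟩ := LinearMap.range_eq_top.1 hr y
  exact ⟨M w, fun i hi => by simp [hM, hi], hw⟩

/-- A lower bound on the one-sided derivative gives linear growth. -/
lemma mul_sub_le_of_le_derivWithin {l : ℝ → ℝ} {a b L : ℝ} (hl : ContDiffOn ℝ 1 l (Ici a))
    (hL : ∀ s ∈ Icc a b, L ≤ derivWithin l (Ici a) s) {s t : ℝ} (hs : a ≤ s) (hst : s ≤ t)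
    (ht : t ≤ b) : L * (t - s) ≤ l t - l s := by
  refine (convex_Icc a b).mul_sub_le_image_sub_of_le_deriv
    (hl.continuousOn.mono Icc_subset_Ici_self) ?_ ?_ s ⟨hs, hst.trans ht⟩ t ⟨hs.trans hst, ht⟩ hst
  · exact (hl.differentiableOn one_ne_zero).mono (interior_subset.trans Icc_subset_Ici_self)
  · intro x hx
    rw [interior_Icc] at hx
    rw [← derivWithin_of_mem_nhds (Ici_mem_nhds hx.1)]
    exact hL x ⟨hx.1.le, hx.2.le⟩

namespace SystemData

variable {nx nu nG N : ℕ} {D : SystemData nx nu nG N}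

/-- If the controls violating `ρmin ≤ g` can steer the end point in every direction, then an
optimal solution has minimal slack variables and an end point of minimal terminal cost. -/
theorem Tame.minimal_of_steer (hT : D.Tame) (hm : ConvexOn ℝ univ D.m)
    (hl : StrictMonoOn D.l (Icc D.ρmin D.ρmax)) {p : Params nx nu} (hc : 0 < p.2.2.2.1)
    {us : Vec nu} (hus : D.g us ≤ D.ρmin) {x : Fin (N + 1) → Vec nx} {u : Fin N → Vec nu}
    {σ : Fin N → ℝ} (hopt : (D.prob p).IsOptimal (x, u, σ))
    (hspan : ∀ y : Vec nx, ∃ w : Fin N → Vec nu, (∀ i ∉ {i | D.g (u i) < D.ρmin}, w i = 0) ∧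
      steer p.1 p.2.1 w = y) :
    (∀ i, σ i = D.ρmin) ∧ ∀ y, D.G y = 0 → D.m (endp N p u) ≤ D.m y := by
  obtain ⟨-, hf, ho⟩ := ((D.prob p).isOptimal_iff _ _ _).1 hopt
  have hV : ∀ i, D.ρmin ≤ σ i ∧ σ i ≤ D.ρmax ∧ D.g (u i) ≤ σ i := hf.1
  have hG : D.G (endp N p u) = 0 := by
    have := hf.2; rwa [endpoint_prob] at this
  have key : ∀ y, D.G y = 0 → ∃ t : ℝ, 0 < t ∧ t < 1 ∧
      D.m (endp N p u) + ∑ i, D.l (σ i) * p.2.2.2.1 ≤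
      D.m (AffineMap.lineMap (endp N p u) y t) +
        ∑ i, D.l ((1 - t) * σ i + t * D.ρmin) * p.2.2.2.1 := by
    intro y hy
    -- `w` is chosen so that `us + w` ends exactly at `y`. Along `c` the end point runs straight to
    -- `y`, inside `G = 0`. Violating controls keep strict slack for small `t`; the others move
    -- towards `us`, and convexity of `g` allows their slacks to shrink.
    obtain ⟨w, hw0, hw⟩ := hspan (y - endp N p fun _ => us)
    let c : ℝ → Fin N → Vec nu := fun t => (1 - t) • u + t • ((fun _ => us) + w)
    have hce : ∀ t, endp N p (c t) = AffineMap.lineMap (endp N p u) y t := fun t => by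
      have h1 : endp N p ((fun _ => us) + w) = y := by
        have : endp N p ((fun _ => us) + w) = endp N p (fun _ => us) + steer p.1 p.2.1 w := by
          simp only [endp, steer_add]; abel
        rw [this, hw]; abel
      rw [endp_lineMap, h1]
    have hcc : Continuous c := by fun_prop
    have hev : ∀ᶠ t in 𝓝[>] (0 : ℝ), ∀ i ∈ {i | D.g (u i) < D.ρmin}, D.g (c t i) < D.ρmin := by
      refine Filter.Eventually.filter_mono nhdsWithin_le_nhds ?_
      refine (eventually_all_finite (Set.toFinite _)).2 fun i hi => ?_
      have h1 : Continuous fun t => D.g (c t i) :=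
        hT.g_cont.comp ((continuous_apply i).comp hcc)
      refine (isOpen_lt h1 continuous_const).mem_nhds ?_
      simpa [c] using hi
    obtain ⟨t, hev, ht0, ht1⟩ := (hev.and (Ioo_mem_nhdsGT (zero_lt_one' ℝ))).exists
    refine ⟨t, ht0, ht1, ?_⟩
    have hfeas : (D.prob p).CtrlFeasible (c t) fun i => (1 - t) * σ i + t * D.ρmin := by
      refine ⟨fun i => ?_, ?_⟩
      · obtain ⟨h1, h2, h3⟩ := hV i
        have hlow : D.ρmin ≤ (1 - t) * σ i + t * D.ρmin := by nlinarith
        refine ⟨hlow, ?_, ?_⟩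
        · change (1 - t) * σ i + t * D.ρmin ≤ D.ρmax
          nlinarith
        · change D.g (c t i) ≤ (1 - t) * σ i + t * D.ρmin
          by_cases hi : D.g (u i) < D.ρmin
          · exact (hev i hi).le.trans hlow
          · have h4 : c t i = (1 - t) • u i + t • us := by simp [c, hw0 i hi]
            rw [h4]
            refine (hT.g_combo (u i) us ht0.le ht1.le).trans ?_
            gcongr
      · change D.G _ = 0
        rw [endpoint_prob, hce, AffineMap.apply_lineMap, hG, hy, AffineMap.lineMap_same_apply]
    have h5 := ho _ _ hfeas
    simp only [DiscProblem.ctrlObjective, endpoint_prob, hce] at h5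
    simpa [prob] using h5
  have hsum : ∀ t : ℝ, 0 < t → t < 1 →
      ∀ i, D.l ((1 - t) * σ i + t * D.ρmin) * p.2.2.2.1 ≤ D.l (σ i) * p.2.2.2.1 := by
    intro t ht0 ht1 i
    obtain ⟨h1, h2, -⟩ := hV i
    refine mul_le_mul_of_nonneg_right (hl.monotoneOn ⟨?_, ?_⟩ ⟨h1, h2⟩ ?_) hc.le <;> nlinarith
  constructor
  · intro i
    by_contra hne
    obtain ⟨h1, h2, -⟩ := hV i
    have hlt : D.ρmin < σ i := lt_of_le_of_ne h1 (Ne.symm hne)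
    -- Taking the present end point as target keeps the terminal cost while a slack above `ρmin`
    -- makes the stage cost drop.
    obtain ⟨t, ht0, ht1, hk⟩ := key _ hG
    have : ∑ i, D.l ((1 - t) * σ i + t * D.ρmin) * p.2.2.2.1 <
        ∑ i, D.l (σ i) * p.2.2.2.1 := by
      refine Finset.sum_lt_sum (fun j _ => hsum t ht0 ht1 j) ⟨i, Finset.mem_univ i, ?_⟩
      refine mul_lt_mul_of_pos_right (hl ⟨?_, ?_⟩ ⟨h1, h2⟩ ?_) hc <;> nlinarith
    rw [AffineMap.lineMap_same_apply] at hk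
    linarith
  · intro y hy
    obtain ⟨t, ht0, ht1, hk⟩ := key y hy
    have h1 := Finset.sum_le_sum fun i (_ : i ∈ Finset.univ) => hsum t ht0 ht1 i
    have h2 := hm.2 (mem_univ (endp N p u)) (mem_univ y) (sub_nonneg.2 ht1.le) ht0.le (by ring)
    rw [← AffineMap.lineMap_apply_module] at h2
    simp only [smul_eq_mul] at h2
    by_contra hlt
    push Not at hlt
    nlinarith

end SystemData

/-! ### Sparse polynomials and products of positive linear factors -/

section Sparse

open Polynomial

/-- Removing the leading term loses at most one sign change, and a single monomial has none. -/
lemma signVariations_lt_card_support {P : ℝ[X]} (hP : P ≠ 0) :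
    P.signVariations + 1 ≤ P.support.card := by
  induction hk : P.support.card generalizing P with
  | zero => exact absurd (Finset.card_eq_zero.1 hk) (by simpa using hP)
  | succ k ih =>
    have h1 := card_support_eraseLead' hk
    by_cases h0 : P.eraseLead = 0
    · have h2 : P.signVariations ≤ 0 := by
        have h3 : P = monomial P.natDegree P.leadingCoeff := by
          have := P.eraseLead_add_monomial_natDegree_leadingCoeff
          rw [h0, zero_add] at this
          exact this.symm
        rw [h3, signVariations_monomial]
      omega
    · have := ih h0 h1
      have := signVariations_le_eraseLead_succ (P := P)
      omega

/-- A nonzero polynomial with at most `n` terms is not divisible by a product of `n` linear factors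
with positive roots. -/
lemma eq_zero_of_prod_dvd {n : ℕ} {μ : Fin n → ℝ} (hμ : ∀ j, 0 < μ j) {P : ℝ[X]}
    (hcard : P.support.card ≤ n) (hdvd : ∏ j, (X - C (μ j)) ∣ P) : P = 0 := by
  by_contra hP
  have h1 : (Finset.univ.val.map μ) ≤ P.roots := by
    have h2 := roots.le_of_dvd hP hdvd
    rwa [roots_prod _ _ (Finset.prod_ne_zero_iff.2 fun j _ => X_sub_C_ne_zero _),
      Multiset.bind_congr (g := fun j => {μ j}) (fun j _ => roots_X_sub_C _),
      Multiset.bind_singleton] at h2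
  have h3 := Multiset.countP_le_of_le (fun x : ℝ => 0 < x) h1
  rw [Multiset.countP_eq_card.2 (by simpa using hμ)] at h3
  simp only [Multiset.card_map, Finset.card_val, Finset.card_univ, Fintype.card_fin] at h3
  -- Descartes' rule counts roots with multiplicity, so the `μ j` need not be distinct: `n` positive
  -- roots require at least `n + 1` terms.
  have h4 := roots_countP_pos_le_signVariations (P := P)
  have h5 := signVariations_lt_card_support hP
  omega

/-- Modulo a product of `n` linear factors with positive roots, every polynomial is a combination
of any `n` given powers of the variable. -/
lemma exists_sparse_congr {n : ℕ} {μ : Fin n → ℝ} (hμ : ∀ j, 0 < μ j) {K : Finset ℕ}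
    (hK : K.card = n) (p : ℝ[X]) :
    ∃ a : K → ℝ, ∏ j, (X - C (μ j)) ∣ p - ∑ k : K, C (a k) * X ^ (k : ℕ) := by
  set χ : ℝ[X] := ∏ j, (X - C (μ j)) with hχ
  have hmon : χ.Monic := monic_prod_of_monic _ _ fun j _ => monic_X_sub_C _
  have hdeg : χ.degree = n := by
    rw [hχ, degree_prod]; simp
  let Ψ : (K → ℝ) →ₗ[ℝ] ℝ[X] := ∑ k : K, (monomial (k : ℕ)) ∘ₗ LinearMap.proj k
  have hΨ : ∀ a, Ψ a = ∑ k : K, C (a k) * X ^ (k : ℕ) := fun a => by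
    simp [Ψ, LinearMap.sum_apply, C_mul_X_pow_eq_monomial]
  have hmem : ∀ q, modByMonicHom χ q ∈ degreeLT ℝ n := fun q => by
    rw [mem_degreeLT, ← hdeg]
    exact degree_modByMonic_lt _ hmon
  -- Coefficients are sent to remainders modulo `χ`. This is injective by `eq_zero_of_prod_dvd`, and
  -- both sides have dimension `n`, so it is onto.
  let Φ : (K → ℝ) →ₗ[ℝ] degreeLT ℝ n :=
    LinearMap.codRestrict _ (modByMonicHom χ ∘ₗ Ψ) fun a => hmem _
  have hinj : Function.Injective Φ := by
    rw [← LinearMap.ker_eq_bot, LinearMap.ker_eq_bot']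
    intro a ha
    have h1 : modByMonicHom χ (Ψ a) = 0 := congrArg Subtype.val ha
    have h2 : χ ∣ Ψ a := (mem_ker_modByMonic hmon).1 h1
    have h3 : (Ψ a).support.card ≤ n := by
      rw [← hK]
      refine Finset.card_le_card fun k hk => ?_
      by_contra hkK
      refine (mem_support_iff.1 hk) ?_
      rw [hΨ, finsetSum_coeff]
      refine Finset.sum_eq_zero fun j _ => ?_
      rw [coeff_C_mul_X_pow, if_neg]
      rintro rfl
      exact hkK j.2
    have h4 := eq_zero_of_prod_dvd hμ h3 h2
    funext k
    have h5 := congrArg (fun q => coeff q (k : ℕ)) h4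
    simp only [hΨ, finsetSum_coeff, coeff_C_mul_X_pow, coeff_zero] at h5
    rw [Finset.sum_eq_single k] at h5
    · simpa using h5
    · intro j _ hj
      rw [if_neg]
      exact fun h => hj (Subtype.ext h.symm)
    · simp
  have hfin : Module.finrank ℝ (K → ℝ) = Module.finrank ℝ (degreeLT ℝ n) := by
    rw [(degreeLTEquiv ℝ n).finrank_eq]; simp [hK]
  have : FiniteDimensional ℝ (degreeLT ℝ n) := (degreeLTEquiv ℝ n).symm.finiteDimensional
  obtain ⟨a, ha⟩ := (LinearMap.injective_iff_surjective_of_finrank_eq_finrank hfin).1 hinj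
    ⟨modByMonicHom χ p, hmem p⟩
  refine ⟨a, ?_⟩
  rw [← hΨ, ← mem_ker_modByMonic hmon, LinearMap.mem_ker, map_sub, sub_eq_zero]
  exact (congrArg Subtype.val ha).symm

/-- Chinese remainder theorem for powers of linear factors with prescribed constant residues. -/
lemma exists_interpolation {n : ℕ} (t c : Fin n → ℂ) (h : ∀ i j, t i = t j → c i = c j) (e : ℕ) :
    ∃ p : ℂ[X], ∀ j, (X - C (t j)) ^ e ∣ p - C (c j) := by
  -- Indexing by values instead of indices keeps the ideals pairwise coprime when `t` has
  -- repetitions.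
  let I : (Set.range t) → Ideal ℂ[X] := fun z => Ideal.span {(X - C (z : ℂ)) ^ e}
  have hI : Pairwise (Function.onFun IsCoprime I) := fun z w hzw => by
    rw [Function.onFun, Ideal.isCoprime_span_singleton_iff]
    exact (pairwise_coprime_X_sub_C Subtype.val_injective hzw).pow
  choose s hs using fun z : Set.range t => z.2
  obtain ⟨p, hp⟩ := Ideal.exists_forall_sub_mem_ideal hI fun z => C (c (s z))
  refine ⟨p, fun j => ?_⟩
  have := hp ⟨t j, j, rfl⟩
  rw [Ideal.mem_span_singleton] at this
  rwa [h _ _ (hs ⟨t j, j, rfl⟩)] at this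

end Sparse

/-! ### Jordan matrices -/

section Jordan

open Polynomial

variable {n : ℕ}

/-- Shift the diagonal entries of `J`. -/
def shiftDiag (J : Matrix (Fin n) (Fin n) ℂ) (d : Fin n → ℂ) : Matrix (Fin n) (Fin n) ℂ :=
  J + Matrix.diagonal d

lemma IsJordanMatrix.shiftDiag {J : Matrix (Fin n) (Fin n) ℂ} (hJ : IsJordanMatrix J)
    {d : Fin n → ℂ} (hd : ∀ i j, J i i = J j j → d i = d j) :
    IsJordanMatrix (LCvx.shiftDiag J d) := by
  refine ⟨fun i j hij hij' => ?_, fun i j hij => ?_⟩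
  · simp [LCvx.shiftDiag, hJ.1 i j hij hij', hij]
  · have hne : i ≠ j := fun h => by simp [h] at hij
    rcases hJ.2 i j hij with h | ⟨h, h'⟩
    · left; simp [LCvx.shiftDiag, h, hne]
    · right; simp [LCvx.shiftDiag, h, hne, h', hd i j h']

lemma IsJordanMatrix.isUpperTriangular {J : Matrix (Fin n) (Fin n) ℂ} (hJ : IsJordanMatrix J) :
    J.BlockTriangular id := by
  intro i j hij
  have hij' : (j : ℕ) < i := hij
  exact hJ.1 i j (fun h => by simp [h] at hij') (by omega)

/-- One step down a Jordan chain: a basis vector is killed or sent to its predecessor in the same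
block. -/
lemma IsJordanMatrix.mulVec_single {T : Matrix (Fin n) (Fin n) ℂ} (hT : IsJordanMatrix T)
    (j : Fin n) : (T - T j j • 1) *ᵥ Pi.single j 1 = 0 ∨ ∃ i : Fin n, (i : ℕ) + 1 = j ∧
      T i i = T j j ∧ (T - T j j • 1) *ᵥ Pi.single j 1 = Pi.single i 1 := by
  by_cases h : ∃ i : Fin n, (i : ℕ) + 1 = j ∧ T i j ≠ 0
  · obtain ⟨i, hij, hne⟩ := h
    obtain ⟨h1, h2⟩ := (hT.2 i j hij).resolve_left hne
    refine Or.inr ⟨i, hij, h2, ?_⟩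
    funext k
    simp only [Matrix.mulVec_single_one, Matrix.col_apply, Matrix.sub_apply, Matrix.smul_apply,
      smul_eq_mul]
    have hij' : i ≠ j := fun h => by simp [h] at hij
    by_cases hk : k = j
    · subst hk; simp [hij'.symm]
    · by_cases hk' : k = i
      · subst hk'; simp [h1, hk]
      · have : T k j = 0 := hT.1 k j hk fun h => hk' (Fin.ext (by omega))
        simp [this, hk, hk']
  · left
    push Not at h
    funext k
    simp only [Matrix.mulVec_single_one, Matrix.col_apply, Matrix.sub_apply, Matrix.smul_apply,
      smul_eq_mul, Pi.zero_apply]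
    by_cases hk : k = j
    · subst hk; simp
    · have : T k j = 0 := by
        by_cases hkj : (k : ℕ) + 1 = j
        · exact h k hkj
        · exact hT.1 k j hk hkj
      simp [this, hk]

/-- Each factor lowers the index by one, so the chain from `j` ends after at most `j + 1` steps. -/
lemma IsJordanMatrix.pow_mulVec_single {T : Matrix (Fin n) (Fin n) ℂ} (hT : IsJordanMatrix T)
    (j : Fin n) (e : ℕ) (he : (j : ℕ) < e) : (T - T j j • 1) ^ e *ᵥ Pi.single j 1 = 0 := by
  induction e generalizing j with
  | zero => omega
  | succ e ih =>
    rw [pow_succ, ← Matrix.mulVec_mulVec]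
    rcases hT.mulVec_single j with h | ⟨i, hij, hii, h⟩
    · rw [h, Matrix.mulVec_zero]
    · rw [h, ← hii]
      exact ih i (by omega)

/-- A polynomial with constant residues at the diagonal entries maps a Jordan matrix to a diagonal
matrix. -/
lemma IsJordanMatrix.aeval_eq_diagonal {T : Matrix (Fin n) (Fin n) ℂ} (hT : IsJordanMatrix T)
    {p : ℂ[X]} {c : Fin n → ℂ} (hp : ∀ j, (X - C (T j j)) ^ n ∣ p - C (c j)) :
    aeval T p = Matrix.diagonal c := by
  refine Matrix.ext_of_mulVec_single fun j => ?_
  obtain ⟨r, hr⟩ := hp j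
  have hp' : p = C (c j) + r * (X - C (T j j)) ^ n := by rw [mul_comm, ← hr]; ring
  have h1 : aeval T (X - C (T j j)) = T - T j j • 1 := by
    simp [Algebra.algebraMap_eq_smul_one]
  rw [hp', map_add, map_mul, map_pow, h1, Matrix.add_mulVec, ← Matrix.mulVec_mulVec,
    hT.pow_mulVec_single j n j.2, Matrix.mulVec_zero, add_zero, aeval_C,
    Algebra.algebraMap_eq_smul_one, Matrix.smul_mulVec, Matrix.one_mulVec]
  funext k
  by_cases hk : k = j
  · subst hk; simp
  · simp [hk]

lemma vecMul_aeval_mul_eq_zero {k : ℕ} {T : Matrix (Fin n) (Fin n) ℂ}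
    {B : Matrix (Fin n) (Fin k) ℂ} {v : Fin n → ℂ} (h : ∀ e : ℕ, v ᵥ* (T ^ e * B) = 0) (p : ℂ[X]) :
    v ᵥ* (aeval T p * B) = 0 := by
  induction p using Polynomial.induction_on' with
  | add p q hp hq => rw [map_add, Matrix.add_mul, Matrix.vecMul_add, hp, hq, add_zero]
  | monomial e a =>
    rw [aeval_monomial, Algebra.algebraMap_eq_smul_one, smul_mul_assoc, one_mul,
      Matrix.smul_mul, Matrix.vecMul_smul, h e, smul_zero]

/-- If the eigenvalues of a controllable Jordan matrix are moved, keeping distinct ones distinct, to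
positive multiples of `I`, then any `n` powers of the new matrix generate the whole space. -/
theorem eq_zero_of_vecMul_powers {k : ℕ} {J : Matrix (Fin n) (Fin n) ℂ} (hJ : IsJordanMatrix J)
    {B : Matrix (Fin n) (Fin k) ℂ}
    (hctrl : ∀ v : Fin n → ℂ, (∀ e : ℕ, v ᵥ* (J ^ e * B) = 0) → v = 0)
    {d : Fin n → ℂ} {μ : Fin n → ℝ} (hμ : ∀ j, 0 < μ j) (hd : ∀ j, J j j + d j = Complex.I * μ j)
    (hinj : ∀ i j, J i i = J j j ↔ μ i = μ j) {K : Finset ℕ} (hK : K.card = n)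
    {v : Fin n → ℂ} (hv : ∀ e ∈ K, v ᵥ* (shiftDiag J d ^ e * B) = 0) : v = 0 := by
  have hI : Complex.I ≠ 0 := Complex.I_ne_zero
  have hd' : ∀ j, d j = Complex.I * μ j - J j j := fun j => by rw [← hd j]; ring
  have hT : IsJordanMatrix (shiftDiag J d) := hJ.shiftDiag fun i j h => by
    rw [hd', hd', h, (hinj i j).1 h]
  have hdiag : ∀ j, shiftDiag J d j j = Complex.I * μ j := fun j => by simp [shiftDiag, ← hd j]
  set T := shiftDiag J d with hTdef
  -- Dividing by `I` makes the characteristic polynomial real with positive roots, while the powers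
  -- change only by nonzero scalars.
  set M : Matrix (Fin n) (Fin n) ℂ := (-Complex.I) • T with hM
  have hMT : T = Complex.I • M := by rw [hM, smul_smul]; simp
  have hχ : aeval M ((∏ j, (X - C (μ j)) : ℝ[X]).map (algebraMap ℝ ℂ)) = 0 := by
    have h1 : M.charpoly = (∏ j, (X - C (μ j)) : ℝ[X]).map (algebraMap ℝ ℂ) := by
      rw [Matrix.charpoly_of_isUpperTriangular, Polynomial.map_prod]
      · refine Finset.prod_congr rfl fun j _ => ?_
        have h2 : M j j = (μ j : ℂ) := by
          rw [hM, Matrix.smul_apply, hdiag, smul_eq_mul, ← mul_assoc]; simp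
        simp [h2]
      · intro i j hij
        simp [hM, hT.isUpperTriangular hij]
    rw [← h1, Matrix.aeval_self_charpoly]
  have hvM : ∀ e ∈ K, v ᵥ* (M ^ e * B) = 0 := fun e he => by
    rw [hM, _root_.smul_pow, Matrix.smul_mul, Matrix.vecMul_smul, hv e he, smul_zero]
  have hvall : ∀ e : ℕ, v ᵥ* (M ^ e * B) = 0 := fun e => by
    -- By Cayley–Hamilton the congruence becomes an identity expressing `M ^ e` through the powers
    -- in `K`.
    obtain ⟨a, q, hq⟩ := exists_sparse_congr hμ hK (X ^ e)
    have h1 := congrArg (fun r : ℝ[X] => aeval M (r.map (algebraMap ℝ ℂ))) hq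
    simp only [Polynomial.map_mul, map_mul, hχ, zero_mul, Polynomial.map_sub, map_sub,
      Polynomial.map_pow, map_X, map_pow, aeval_X, Polynomial.map_sum, map_sum, map_C, aeval_C,
      sub_eq_zero] at h1
    rw [h1, Matrix.sum_mul, Matrix.vecMul_sum]
    refine Finset.sum_eq_zero fun j _ => ?_
    rw [Algebra.algebraMap_eq_smul_one, smul_mul_assoc, one_mul, Matrix.smul_mul,
      Matrix.vecMul_smul, hvM j j.2, smul_zero]
  have hvT : ∀ e : ℕ, v ᵥ* (T ^ e * B) = 0 := fun e => by
    rw [hMT, _root_.smul_pow, Matrix.smul_mul, Matrix.vecMul_smul, hvall, smul_zero]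
  -- Equal new eigenvalues carry equal shifts, so the diagonal of shifts is `p(T)` and `J = T -
  -- p(T)` is a polynomial in `T`.
  obtain ⟨p, hp⟩ := exists_interpolation (fun j => T j j) d (fun i j h => by
    have h2 : μ i = μ j := by
      simp only [hdiag] at h
      exact_mod_cast mul_left_cancel₀ hI h
    rw [hd', hd', h2, (hinj i j).2 h2]) n
  have hpT := hT.aeval_eq_diagonal hp
  have hJT : J = aeval T (X - p) := by
    rw [map_sub, aeval_X, hpT, hTdef, shiftDiag]; simp
  refine hctrl v fun e => ?_
  rw [hJT, ← map_pow]
  exact vecMul_aeval_mul_eq_zero hvT _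

end Jordan

/-! ### Genericity of the perturbation -/

section Null

/-- A closed set that meets every line through some point outside it in finitely many points is a
null set. -/
lemma measure_eq_zero_of_finite_lines {E : Type*} [NormedAddCommGroup E] [NormedSpace ℝ E]
    [FiniteDimensional ℝ E] [MeasurableSpace E] [BorelSpace E] (μ : Measure E)
    [μ.IsAddHaarMeasure] {Z : Set E} (hZ : IsClosed Z) {x₀ : E} (h₀ : x₀ ∉ Z)
    (h : ∀ w : E, {t : ℝ | x₀ + t • w ∈ Z}.Finite) : μ Z = 0 := by
  have hmeas : MeasurableSet ((fun x => x₀ + x) ⁻¹' Z) :=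
    (hZ.preimage (by fun_prop)).measurableSet
  rw [← measure_preimage_add μ x₀ Z]
  set Y := (fun x => x₀ + x) ⁻¹' Z with hY
  have hY0 : (0 : E) ∉ Y := by simpa [hY] using h₀
  have h1 : μ Y = (μ.comap ((↑) : ({0}ᶜ : Set E) → E)) ((↑) ⁻¹' Y) := by
    rw [comap_subtype_coe_apply (measurableSet_singleton _).compl, Subtype.image_preimage_coe,
      inter_eq_right.2]
    intro y hy h'
    exact hY0 (by rwa [mem_singleton_iff.1 h'] at hy)
  -- In polar coordinates around `x₀` each ray meets the set in finitely many radii, so Fubini gives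
  -- measure zero.
  have hp := μ.measurePreserving_homeomorphUnitSphereProd
  set S := (homeomorphUnitSphereProd E).symm ⁻¹' ((↑) ⁻¹' Y) with hS
  have hSm : MeasurableSet S :=
    (homeomorphUnitSphereProd E).symm.continuous.measurable (measurable_subtype_coe hmeas)
  have h2 : ((↑) ⁻¹' Y : Set ({0}ᶜ : Set E)) = homeomorphUnitSphereProd E ⁻¹' S := by
    ext y; simp [hS]
  rw [h1, h2, hp.measure_preimage hSm.nullMeasurableSet, Measure.measure_prod_null hSm]
  refine Filter.Eventually.of_forall fun x => ?_
  refine withDensity_absolutelyContinuous _ _ ?_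
  rw [comap_subtype_coe_apply measurableSet_Ioi]
  refine Set.Finite.measure_zero (((h x.1).subset ?_)) _
  rintro _ ⟨t, ht, rfl⟩
  simpa [hS, hY, homeomorphUnitSphereProd_symm_apply_coe] using ht

end Null

/-! ### Rank certificates for blocks of matrix powers -/

section PowCols

variable {n k : ℕ} {R : Type*} [CommRing R]

/-- The blocks `T ^ e * B`, `e ∈ K`, side by side. -/
def powCols (K : Finset ℕ) (T : Matrix (Fin n) (Fin n) R) (B : Matrix (Fin n) (Fin k) R) :
    Matrix (Fin n) (K × Fin k) R :=
  Matrix.of fun i x => (T ^ (x.1 : ℕ) * B) i x.2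

lemma vecMul_powCols_eq_zero_iff {K : Finset ℕ} {T : Matrix (Fin n) (Fin n) R}
    {B : Matrix (Fin n) (Fin k) R} {v : Fin n → R} :
    v ᵥ* powCols K T B = 0 ↔ ∀ e ∈ K, v ᵥ* (T ^ e * B) = 0 := by
  constructor
  · intro h e he
    funext j
    exact congrFun h (⟨e, he⟩, j)
  · intro h
    funext x
    exact congrFun (h x.1 x.1.2) x.2

lemma powCols_map {S : Type*} [CommRing S] (f : R →+* S) (K : Finset ℕ)
    (T : Matrix (Fin n) (Fin n) R) (B : Matrix (Fin n) (Fin k) R) :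
    (powCols K T B).map f = powCols K (T.map f) (B.map f) := by
  ext i x
  have h1 : (T ^ (x.1 : ℕ) * B).map f = (T.map f) ^ (x.1 : ℕ) * B.map f := by
    rw [Matrix.map_mul]
    congr 1
    exact map_pow f.mapMatrix T x.1
  exact congrFun (congrFun h1 i) x.2

/-- A right inverse `D` found at one parameter turns the rank condition at all parameters into
nonvanishing of the square determinant of `C * D`, which suffices by `eq_zero_of_vecMul_of_det`. -/
lemma exists_right_inverse_of_vecMul {m F : Type*} [Fintype m] [DecidableEq m] [Field F]
    {C : Matrix (Fin n) m F} (h : ∀ v, v ᵥ* C = 0 → v = 0) : ∃ D : Matrix m (Fin n) F, C * D = 1 := by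
  have hker : LinearMap.ker Cᵀ.toLin' = ⊥ := by
    rw [LinearMap.ker_eq_bot']
    intro v hv
    rw [Matrix.toLin'_apply, Matrix.mulVec_transpose] at hv
    exact h v hv
  obtain ⟨g, hg⟩ := Cᵀ.toLin'.exists_leftInverse_of_injective hker
  refine ⟨(LinearMap.toMatrix' g)ᵀ, ?_⟩
  have h1 := congrArg LinearMap.toMatrix' hg
  rw [LinearMap.toMatrix'_comp, LinearMap.toMatrix'_toLin', LinearMap.toMatrix'_id] at h1
  rw [← Matrix.transpose_inj, Matrix.transpose_mul, Matrix.transpose_transpose, h1,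
    Matrix.transpose_one]

lemma eq_zero_of_vecMul_of_det {m F : Type*} [Fintype m] [Field F]
    {C : Matrix (Fin n) m F} {D : Matrix m (Fin n) F} (h : (C * D).det ≠ 0) {v : Fin n → F}
    (hv : v ᵥ* C = 0) : v = 0 := by
  refine Matrix.eq_zero_of_vecMul_eq_zero h ?_
  rw [← Matrix.vecMul_vecMul, hv, Matrix.zero_vecMul]

end PowCols

section Generic

open Polynomial

variable {n k : ℕ}

/-- The determinant that detects whether the chosen blocks span, along a complex line of shifts, as
a polynomial. -/
def linePoly (K : Finset ℕ) (J : Matrix (Fin n) (Fin n) ℂ) (B : Matrix (Fin n) (Fin k) ℂ)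
    (D : Matrix (K × Fin k) (Fin n) ℂ) (a b : Fin n → ℂ) : ℂ[X] :=
  (powCols K (J.map C + Matrix.diagonal fun i => C (a i) + X * C (b i)) (B.map C) * D.map C).det

lemma eval_linePoly (K : Finset ℕ) (J : Matrix (Fin n) (Fin n) ℂ) (B : Matrix (Fin n) (Fin k) ℂ)
    (D : Matrix (K × Fin k) (Fin n) ℂ) (a b : Fin n → ℂ) (τ : ℂ) :
    (linePoly K J B D a b).eval τ =
      (powCols K (shiftDiag J fun i => a i + τ * b i) B * D).det := by
  have h1 : ∀ {p q : Type} (M : Matrix p q ℂ), (M.map C).map (evalRingHom τ) = M := fun M => by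
    ext; simp
  rw [linePoly, ← coe_evalRingHom, RingHom.map_det, RingHom.mapMatrix_apply, Matrix.map_mul,
    powCols_map, h1, h1]
  congr 3
  ext i j
  by_cases hij : i = j
  · subst hij; simpa [shiftDiag] using mul_comm _ _
  · simp [shiftDiag, hij]

/-- Only finitely many slopes `a` identify two points of `s`, and a large `c` gives positivity. The
added term depends on `z.re` alone, so it is an admissible shift of conjugate eigenvalues. -/
lemma exists_separating_slope (s : Finset ℂ) : ∃ a c : ℝ,
    (∀ z ∈ s, 0 < z.im + (c + a * z.re)) ∧
      ∀ z ∈ s, ∀ w ∈ s, z.im + a * z.re = w.im + a * w.re → z = w := by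
  obtain ⟨a, ha⟩ := Infinite.exists_notMem_finset
    -- Pairs with equal real parts contribute the default value `0`; excluding it does no harm.
    ((s ×ˢ s).image fun x => -(x.1.im - x.2.im) / (x.1.re - x.2.re))
  refine ⟨a, 1 + ∑ z ∈ s, |z.im + a * z.re|, fun z hz => ?_, fun z hz w hw h => ?_⟩
  · have h1 := Finset.single_le_sum (f := fun z : ℂ => |z.im + a * z.re|)
      (fun _ _ => abs_nonneg _) hz
    have h2 := neg_abs_le (z.im + a * z.re)
    linarith
  · by_cases hre : z.re = w.re
    · rw [hre] at h
      exact Complex.ext hre (by linarith)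
    · exfalso
      refine ha (Finset.mem_image.2 ⟨(z, w), Finset.mem_product.2 ⟨hz, hw⟩, ?_⟩)
      have : z.re - w.re ≠ 0 := sub_ne_zero.2 hre
      field_simp
      linarith

variable {A : Matrix (Fin n) (Fin n) ℝ}

lemma shiftOf_add_smul (p q : shifts A) (t : ℝ) (z : ℂ) :
    shiftOf (p + t • q) z = shiftOf p z + t * shiftOf q z := by
  unfold shiftOf
  split_ifs <;> simp

lemma continuous_shiftOf (z : ℂ) : Continuous fun q : shifts A => shiftOf q z := by
  unfold shiftOf
  split_ifs
  · fun_prop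
  · fun_prop

lemma shiftOf_zero (z : ℂ) : shiftOf (0 : shifts A) z = 0 := by
  unfold shiftOf
  split_ifs <;> simp

/-- The shift given by a conjugation invariant function. -/
def shiftOfFun (A : Matrix (Fin n) (Fin n) ℝ) (f : ℂ → ℝ) (hf : ∀ z, f (conj z) = f z) :
    shifts A :=
  ⟨WithLp.toLp 2 fun z => f z, fun a b h => by simp [h, hf]⟩

lemma shiftOf_shiftOfFun {f : ℂ → ℝ} (hf : ∀ z, f (conj z) = f z) {z : ℂ} (hz : z ∈ eigs A) :
    shiftOf (shiftOfFun A f hf) z = f z := by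
  simp [shiftOf, shiftOfFun, hz]

/-- For almost every shift of the eigenvalues of a controllable Jordan matrix, `n` given powers of
the shifted matrix generate the whole space. -/
theorem ae_eq_zero_of_vecMul_powers {J : Matrix (Fin n) (Fin n) ℂ} (hJ : IsJordanMatrix J)
    (hJA : ∀ j, J j j ∈ eigs A) {B : Matrix (Fin n) (Fin k) ℂ}
    (hctrl : ∀ v : Fin n → ℂ, (∀ e : ℕ, v ᵥ* (J ^ e * B) = 0) → v = 0)
    {K : Finset ℕ} (hK : K.card = n) :
    ∀ᵐ q : shifts A ∂Measure.addHaar, ∀ v : Fin n → ℂ,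
      (∀ e ∈ K, v ᵥ* ((shiftDiag J fun i => (shiftOf q (J i i) : ℂ)) ^ e * B) = 0) → v = 0 := by
  obtain ⟨a, c, hpos, hsep⟩ := exists_separating_slope (eigs A)
  -- The complex shift `r + I s` removes the real part of each eigenvalue and makes its imaginary
  -- part positive and separating. A real shift alone could not move nonreal eigenvalues to the
  -- imaginary axis at prescribed heights.
  let r : shifts A := shiftOfFun A (fun z => -z.re) (by simp)
  let s : shifts A := shiftOfFun A (fun z => c + a * z.re) (by simp)
  have hr : ∀ j, shiftOf r (J j j) = -(J j j).re := fun j => shiftOf_shiftOfFun _ (hJA j)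
  have hs : ∀ j, shiftOf s (J j j) = c + a * (J j j).re := fun j => shiftOf_shiftOfFun _ (hJA j)
  let F : shifts A → Fin n → ℂ := fun q i => (shiftOf q (J i i) : ℂ)
  have hcomplex : ∀ v : Fin n → ℂ, v ᵥ* powCols K
      (shiftDiag J fun i => F r i + Complex.I * F s i) B = 0 → v = 0 := fun v hv => by
    refine eq_zero_of_vecMul_powers hJ hctrl (μ := fun j => (J j j).im + (c + a * (J j j).re))
      (fun j => hpos _ (hJA j)) (fun j => ?_) (fun i j => ⟨fun h => by rw [h], fun h => ?_⟩) hK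
      (vecMul_powCols_eq_zero_iff.1 hv)
    · simp only [F, hr, hs]
      apply Complex.ext <;> simp
    · exact hsep _ (hJA i) _ (hJA j) (by linarith)
  obtain ⟨D, hD⟩ := exists_right_inverse_of_vecMul hcomplex
  have hne : linePoly K J B D (F r) (F s) ≠ 0 := fun h => by
    have h1 := eval_linePoly K J B D (F r) (F s) Complex.I
    rw [h, hD] at h1
    simp at h1
  have hfin : ∀ {p : ℂ[X]}, p ≠ 0 → {t : ℝ | p.eval (t : ℂ) = 0}.Finite := fun {p} hp => by
    refine Set.Finite.preimage (f := ((↑) : ℝ → ℂ)) Complex.ofReal_injective.injOn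
      (s := {z | p.eval z = 0}) ?_
    refine (p.roots.toFinset.finite_toSet).subset fun z hz => ?_
    simpa [hp] using hz
  -- The polynomial equals `1` at `I`, so it is nonzero at some real `τ`. The real shift `r + τ • s`
  -- is the base point for all lines.
  obtain ⟨τ, hτ⟩ := (hfin hne).infinite_compl.nonempty
  have hline : ∀ (p q : shifts A) (t : ℝ), (linePoly K J B D (F p) (F q)).eval (t : ℂ) =
      (powCols K (shiftDiag J (F (p + t • q))) B * D).det := fun p q t => by
    rw [eval_linePoly]
    congr 4
    funext i
    simp [F, shiftOf_add_smul]
  let Z : Set (shifts A) := {q | (powCols K (shiftDiag J (F q)) B * D).det = 0}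
  have hF : Continuous F := continuous_pi fun i =>
    Complex.continuous_ofReal.comp (continuous_shiftOf (J i i))
  have hcont : Continuous fun q => (powCols K (shiftDiag J (F q)) B * D).det := by
    refine Continuous.matrix_det (Continuous.matrix_mul (continuous_matrix fun i x => ?_)
      continuous_const)
    have h1 : Continuous fun q => shiftDiag J (F q) :=
      continuous_const.add hF.matrix_diagonal
    exact ((h1.pow _).matrix_mul continuous_const).matrix_elem i x.2
  have hZ : Measure.addHaar Z = 0 := by
    have h0 : r + τ • s ∉ Z := by
      change ¬ ((powCols K (shiftDiag J (F (r + τ • s))) B * D).det = 0)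
      rw [← hline]; exact hτ
    refine measure_eq_zero_of_finite_lines _ (isClosed_eq hcont continuous_const) h0 fun w => ?_
    have h1 : linePoly K J B D (F (r + τ • s)) (F w) ≠ 0 := fun h => by
      have h2 := hline (r + τ • s) w 0
      rw [h, zero_smul, add_zero, eval_zero] at h2
      exact h0 h2.symm
    refine (hfin h1).subset fun t ht => ?_
    change eval _ _ = 0
    rw [hline]; exact ht
  filter_upwards [measure_eq_zero_iff_ae_notMem.1 hZ] with q hq v hv
  exact eq_zero_of_vecMul_of_det (D := D) hq (vecMul_powCols_eq_zero_iff.2 hv)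

end Generic

/-! ### The perturbed matrix is real and generically spanning -/

section Real

open Polynomial

variable {n k : ℕ} {A : Matrix (Fin n) (Fin n) ℝ} {Q J : Matrix (Fin n) (Fin n) ℂ}

lemma conj_pow_of_isUnit (hQ : IsUnit Q) (M : Matrix (Fin n) (Fin n) ℂ) (e : ℕ) :
    (Q⁻¹ * M * Q) ^ e = Q⁻¹ * M ^ e * Q := by
  have hdet := (Matrix.isUnit_iff_isUnit_det Q).1 hQ
  induction e with
  | zero => simp [Matrix.nonsing_inv_mul _ hdet]
  | succ e ih =>
    calc (Q⁻¹ * M * Q) ^ (e + 1) = Q⁻¹ * M ^ e * (Q * Q⁻¹) * M * Q := by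
          rw [pow_succ, ih]; simp only [Matrix.mul_assoc]
      _ = Q⁻¹ * M ^ (e + 1) * Q := by
          rw [Matrix.mul_nonsing_inv _ hdet, pow_succ]; simp only [Matrix.mul_assoc, Matrix.one_mul]

lemma aeval_conj_of_isUnit (hQ : IsUnit Q) (M : Matrix (Fin n) (Fin n) ℂ) (p : ℂ[X]) :
    aeval (Q⁻¹ * M * Q) p = Q⁻¹ * aeval M p * Q := by
  induction p using Polynomial.induction_on' with
  | add p q hp hq => rw [map_add, map_add, hp, hq, Matrix.mul_add, Matrix.add_mul]
  | monomial e a =>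
    rw [aeval_monomial, aeval_monomial, conj_pow_of_isUnit hQ]
    simp [Algebra.algebraMap_eq_smul_one]

lemma IsJordanForm.mem_eigs_iff (h : IsJordanForm A Q J) {z : ℂ} :
    z ∈ eigs A ↔ ∃ j, J j j = z := by
  obtain ⟨hQ, hJ, hA⟩ := h
  have h1 : (A.map Complex.ofReal).charpoly = J.charpoly := by
    rw [hA]
    exact Matrix.charpoly_units_conj' hQ.unit J
  have h2 : (∏ j, (X - C (J j j))) ≠ 0 := Finset.prod_ne_zero_iff.2 fun j _ => X_sub_C_ne_zero _
  rw [eigs, Multiset.mem_toFinset, h1,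
    Matrix.charpoly_of_isUpperTriangular _ hJ.isUpperTriangular, mem_roots h2, IsRoot, eval_prod,
    Finset.prod_eq_zero_iff]
  simp [sub_eq_zero, eq_comm]

lemma conj_mem_eigs {z : ℂ} (hz : z ∈ eigs A) : conj z ∈ eigs A := by
  have h0 : (A.map Complex.ofReal).charpoly ≠ 0 := (Matrix.charpoly_monic _).ne_zero
  rw [eigs, Multiset.mem_toFinset, mem_roots h0] at hz ⊢
  have h1 := hz.map (f := starRingEnd ℂ)
  rwa [← Matrix.charpoly_map, Matrix.map_map, show (starRingEnd ℂ : ℂ → ℂ) ∘ Complex.ofReal =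
    Complex.ofReal from funext Complex.conj_ofReal] at h1

lemma shiftOf_conj (q : shifts A) {z : ℂ} (hz : z ∈ eigs A) : shiftOf q (conj z) = shiftOf q z := by
  simp only [shiftOf, hz, conj_mem_eigs hz, dif_pos]
  exact (q.2 ⟨z, hz⟩ ⟨conj z, conj_mem_eigs hz⟩ rfl).symm

/-- The real matrix obtained from the shift `q`. -/
def perturbed (Q J : Matrix (Fin n) (Fin n) ℂ) (q : shifts A) : Matrix (Fin n) (Fin n) ℝ :=
  (Q⁻¹ * (J + Matrix.diagonal fun i => ((shiftOf q (J i i) : ℝ) : ℂ)) * Q).map Complex.re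

/-- The shift part equals `p(A)` for an interpolating polynomial `p`. As `q` is conjugation
invariant, the conjugate of `p` interpolates the same data; as `A` is real, conjugating `p(A)`
conjugates only the coefficients. -/
lemma IsJordanForm.conj_diagonal (h : IsJordanForm A Q J) (q : shifts A) :
    (Q⁻¹ * (Matrix.diagonal fun i => ((shiftOf q (J i i) : ℝ) : ℂ)) * Q).map (starRingEnd ℂ) =
      Q⁻¹ * (Matrix.diagonal fun i => ((shiftOf q (J i i) : ℝ) : ℂ)) * Q := by
  obtain ⟨p, hp⟩ := exists_interpolation (fun j => J j j)
    (fun j => ((shiftOf q (J j j) : ℝ) : ℂ)) (fun i j hij => congrArg (fun z => ((shiftOf q z : ℝ) : ℂ)) hij) n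
  have hp' : ∀ j, (X - C (J j j)) ^ n ∣
      p.map (starRingEnd ℂ) - C ((shiftOf q (J j j) : ℝ) : ℂ) := fun j => by
    have hj := h.mem_eigs_iff.2 ⟨j, rfl⟩
    obtain ⟨i, hi⟩ := h.mem_eigs_iff.1 (conj_mem_eigs hj)
    have h1 := Polynomial.map_dvd (starRingEnd ℂ) (hp i)
    simpa [hi, shiftOf_conj q hj] using h1
  have h1 := h.2.1.aeval_eq_diagonal hp
  have h2 := h.2.1.aeval_eq_diagonal hp'
  have h3 : (starRingEnd ℂ).mapMatrix (A.map Complex.ofReal) = A.map Complex.ofReal := by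
    ext i j; simp
  have h4 := map_aeval_eq_aeval_map (φ := starRingEnd ℂ) (ψ := (starRingEnd ℂ).mapMatrix)
    (by ext a i j; by_cases hij : i = j <;> simp [Matrix.algebraMap_matrix_apply, hij]) p (A.map Complex.ofReal)
  rw [h3, h.2.2, aeval_conj_of_isUnit h.1, aeval_conj_of_isUnit h.1, h1, h2] at h4
  exact h4

lemma IsJordanForm.isPerturbation (h : IsJordanForm A Q J) (q : shifts A) :
    IsPerturbation Q J q (perturbed Q J q) := by
  have h1 : Q⁻¹ * (J + Matrix.diagonal fun i => ((shiftOf q (J i i) : ℝ) : ℂ)) * Q =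
      A.map Complex.ofReal +
        Q⁻¹ * (Matrix.diagonal fun i => ((shiftOf q (J i i) : ℝ) : ℂ)) * Q := by
    rw [h.2.2, Matrix.mul_add, Matrix.add_mul]
  have h2 := h.conj_diagonal q
  unfold IsPerturbation perturbed
  rw [h1]
  ext i j
  have h3 := congrFun (congrFun h2 i) j
  rw [Matrix.map_apply, Complex.conj_eq_iff_re] at h3
  simp only [Matrix.map_apply, Matrix.add_apply, Complex.add_re, Complex.ofReal_re,
    Complex.ofReal_add, h3]

lemma IsPerturbation.eq {q : shifts A} {A₁ A₂ : Matrix (Fin n) (Fin n) ℝ}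
    (h₁ : IsPerturbation Q J q A₁) (h₂ : IsPerturbation Q J q A₂) : A₁ = A₂ :=
  Matrix.map_injective Complex.ofReal_injective (h₁.trans h₂.symm)

lemma IsJordanForm.perturbed_zero (h : IsJordanForm A Q J) :
    perturbed Q J (0 : shifts A) = A := by
  refine (h.isPerturbation 0).eq ?_
  unfold IsPerturbation
  simp only [shiftOf_zero, Complex.ofReal_zero, Matrix.diagonal_zero, add_zero]
  exact h.2.2

lemma continuous_perturbed : Continuous fun q : shifts A => perturbed Q J q := by
  unfold perturbed
  have h1 : Continuous fun q : shifts A => fun i => ((shiftOf q (J i i) : ℝ) : ℂ) :=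
    continuous_pi fun i => Complex.continuous_ofReal.comp (continuous_shiftOf (J i i))
  exact ((continuous_const.matrix_mul (continuous_const.add h1.matrix_diagonal)).matrix_mul
    continuous_const).matrix_map Complex.continuous_re

lemma vecMul_map_ofReal {m : Type*} (v : Fin n → ℝ) (C : Matrix (Fin n) m ℝ) :
    (fun i => (v i : ℂ)) ᵥ* C.map Complex.ofReal = fun j => ((v ᵥ* C) j : ℂ) := by
  funext j
  simp [Matrix.vecMul, dotProduct]

lemma map_pow_mul_ofReal (A : Matrix (Fin n) (Fin n) ℝ) (B : Matrix (Fin n) (Fin k) ℝ) (e : ℕ) :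
    (A ^ e * B).map Complex.ofReal = A.map Complex.ofReal ^ e * B.map Complex.ofReal := by
  have h1 : (A ^ e).map Complex.ofReal = A.map Complex.ofReal ^ e :=
    map_pow Complex.ofRealHom.mapMatrix A e
  rw [← h1]
  exact Matrix.map_mul (f := Complex.ofRealHom)

/-- A real right inverse of the controllability matrix remains one over `ℂ`. -/
lemma DiscProblem.Controllable.eq_zero {nG N : ℕ} {P : DiscProblem n k nG N}
    (h : P.Controllable) {v : Fin n → ℂ}
    (hv : ∀ e : ℕ, v ᵥ* (P.A.map Complex.ofReal ^ e * P.B.map Complex.ofReal) = 0) : v = 0 := by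
  have h1 : Function.Surjective P.controllabilityMatrix.mulVec := by
    have h2 : LinearMap.range P.controllabilityMatrix.mulVecLin = ⊤ := by
      refine Submodule.eq_top_of_finrank_eq ?_
      have h3 : Module.finrank ℝ (LinearMap.range P.controllabilityMatrix.mulVecLin) = n := h
      simpa using h3
    exact LinearMap.range_eq_top.1 h2
  obtain ⟨R, hR⟩ := Matrix.mulVec_surjective_iff_exists_right_inverse.1 h1
  have h4 : P.controllabilityMatrix.map Complex.ofReal * R.map Complex.ofReal = 1 := by
    have : (P.controllabilityMatrix * R).map Complex.ofReal =
        (1 : Matrix (Fin n) (Fin n) ℝ).map Complex.ofReal := by rw [hR]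
    rw [Matrix.map_one _ Complex.ofReal_zero Complex.ofReal_one] at this
    rw [← this]
    exact (Matrix.map_mul (f := Complex.ofRealHom)).symm
  have h5 : v ᵥ* P.controllabilityMatrix.map Complex.ofReal = 0 := by
    funext x
    have := congrFun (hv x.1) x.2
    rw [← map_pow_mul_ofReal] at this
    exact this
  rw [← Matrix.vecMul_one v, ← h4, ← Matrix.vecMul_vecMul, h5, Matrix.zero_vecMul]

/-- For almost every shift, any `n` among the first `N` powers of the perturbed matrix generate the
whole space. -/
theorem ae_spanning {nG N : ℕ} {P : DiscProblem n k nG N} (hP : P.Controllable)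
    (h : IsJordanForm P.A Q J) (N : ℕ) :
    ∀ᵐ q : shifts P.A ∂Measure.addHaar, ∀ A', IsPerturbation Q J q A' →
      ∀ K ∈ (Finset.range N).powersetCard n, ∀ v : Fin n → ℝ,
        (∀ e ∈ K, v ᵥ* (A' ^ e * P.B) = 0) → v = 0 := by
  have hQ := h.1
  have hdet := (Matrix.isUnit_iff_isUnit_det Q).1 hQ
  -- In Jordan coordinates the input matrix is `Q * B`, and row vectors `v` for `J` correspond to `v
  -- ᵥ* Q` for `A`.
  have hctrl : ∀ v : Fin n → ℂ, (∀ e : ℕ, v ᵥ* (J ^ e * (Q * P.B.map Complex.ofReal)) = 0) →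
      v = 0 := fun v hv => by
    have h1 : v ᵥ* Q = 0 := hP.eq_zero fun e => by
      rw [h.2.2, conj_pow_of_isUnit hQ, Matrix.vecMul_vecMul]
      have : Q * (Q⁻¹ * J ^ e * Q * P.B.map Complex.ofReal) =
          J ^ e * (Q * P.B.map Complex.ofReal) := by
        rw [← Matrix.mul_assoc, ← Matrix.mul_assoc, ← Matrix.mul_assoc,
          Matrix.mul_nonsing_inv _ hdet, Matrix.one_mul, Matrix.mul_assoc]
      rw [this, hv e]
    exact Matrix.eq_zero_of_vecMul_eq_zero hdet.ne_zero h1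
  have hall : ∀ᵐ q : shifts P.A ∂Measure.addHaar, ∀ K ∈ (Finset.range N).powersetCard n,
      ∀ v : Fin n → ℂ, (∀ e ∈ K, v ᵥ* ((shiftDiag J fun i => (shiftOf q (J i i) : ℂ)) ^ e *
        (Q * P.B.map Complex.ofReal)) = 0) → v = 0 :=
    (Filter.eventually_all_finset _).2 fun K hK =>
      ae_eq_zero_of_vecMul_powers h.2.1 (fun j => h.mem_eigs_iff.2 ⟨j, rfl⟩) hctrl
        (Finset.mem_powersetCard.1 hK).2
  filter_upwards [hall] with q hq A' hA' K hK v hv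
  have h1 : (fun i => (v i : ℂ)) ᵥ* Q⁻¹ = 0 := hq K hK _ fun e he => by
    have h2 := vecMul_map_ofReal v (A' ^ e * P.B)
    rw [hv e he, map_pow_mul_ofReal, hA', conj_pow_of_isUnit hQ] at h2
    rw [Matrix.vecMul_vecMul, ← Matrix.mul_assoc, ← Matrix.mul_assoc]
    simpa [shiftDiag, funext_iff] using h2
  have h3 : (fun i => (v i : ℂ)) = 0 := by
    rw [← Matrix.vecMul_one (fun i => (v i : ℂ)), ← Matrix.nonsing_inv_mul _ hdet,
      ← Matrix.vecMul_vecMul, h1, Matrix.zero_vecMul]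
  funext i
  have := congrFun h3 i
  simpa using this

end Real

/-! ### The two-phase problem -/

namespace SystemData

variable {nx nu nG N : ℕ} {D : SystemData nx nu nG N}

/-- The parameters of the two-phase problem. -/
def phaseParams (D : SystemData nx nu nG N) (ts : ℝ) : Params nx nu :=
  (D.Ad (D.tf - ts), D.Bd (D.tf - ts), D.xinit ts, (D.tf - ts) / N, ts * D.l D.ρmin)

lemma twoPhase_eq_prob (ts : ℝ) : D.twoPhase ts = D.prob (D.phaseParams ts) := rfl

section MatrixNorm

attribute [local instance] Matrix.linftyOpNormedRing Matrix.linftyOpNormedAlgebra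

lemma continuous_matrix_exp :
    Continuous (NormedSpace.exp : Matrix (Fin nx) (Fin nx) ℝ → Matrix (Fin nx) (Fin nx) ℝ) :=
  NormedSpace.exp_continuous

end MatrixNorm

lemma continuous_expIntegral : Continuous D.expIntegral := by
  refine continuous_matrix fun i j => ?_
  have h1 : Continuous fun τ : ℝ => (NormedSpace.exp (τ • D.Ac)) i j :=
    (continuous_matrix_exp.comp (by fun_prop)).matrix_elem i j
  exact intervalIntegral.continuous_primitive (fun a b => h1.intervalIntegrable a b) 0

lemma continuous_phaseParams : Continuous D.phaseParams := by
  have h1 : Continuous D.Ad := continuous_matrix_exp.comp (by fun_prop)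
  have h2 : Continuous D.Bd :=
    (continuous_expIntegral.comp (by fun_prop)).matrix_mul continuous_const
  have h3 : Continuous D.xinit :=
    (Continuous.mulE (continuous_matrix_exp.comp (by fun_prop)) continuous_const).add
      (Continuous.mulE (continuous_expIntegral.matrix_mul continuous_const) continuous_const)
  unfold phaseParams
  exact (h1.comp (by fun_prop)).prodMk ((h2.comp (by fun_prop)).prodMk
    (h3.prodMk ((by fun_prop : Continuous fun ts : ℝ => (D.tf - ts) / N).prodMk (by fun_prop))))

/-- At time `0` the stage cost is `l` times a positive constant. -/
lemma LongHorizonAssumption.contDiffOn_l (hD : D.Standing) {tb : ℝ}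
    (hb : D.LongHorizonAssumption tb) : ContDiffOn ℝ 1 D.l (Ici D.ρmin) := by
  have h1 := (hb.regular 0 ⟨le_rfl, hb.tb_pos.le⟩).cost_contDiffOn ⟨0, hD.N_pos⟩
  have hc : (D.tf - 0) / (N : ℝ) ≠ 0 := by
    have := hD.tf_pos
    have : (0 : ℝ) < N := Nat.cast_pos.2 hD.N_pos
    rw [sub_zero]; positivity
  refine (h1.mul (contDiffOn_const (c := ((D.tf - 0) / (N : ℝ))⁻¹))).congr fun s _ => ?_
  exact (mul_inv_cancel_right₀ hc _).symm

lemma LongHorizonAssumption.tame (hD : D.Standing) {tb : ℝ} (hb : D.LongHorizonAssumption tb) :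
    D.Tame where
  g_convex := hD.g_convex
  g_cont := continuousOn_univ.1 (hD.g_convex.continuousOn isOpen_univ)
  m_cont := hb.onePhase_regular.m_contDiff.continuous
  l_cont := (hb.contDiffOn_l hD).continuousOn
  compact := hb.onePhase_regular.compact_max

lemma LongHorizonAssumption.mStar_le {tb : ℝ} (hb : D.LongHorizonAssumption tb) {y : Vec nx}
    (hy : D.G y = 0) : D.mStar ≤ D.m y := by
  obtain ⟨z, -, -, -, hz⟩ := hb.onePhase_longHorizon
  exact csInf_le ⟨_, by rintro _ ⟨x, hx, rfl⟩; exact hz x hx⟩ ⟨y, hy, rfl⟩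

lemma LongHorizonAssumption.exists_minimizer {tb : ℝ} (hb : D.LongHorizonAssumption tb) :
    ∃ y, D.G y = 0 ∧ D.m y = D.mStar := by
  obtain ⟨z, -, -, hz0, hz⟩ := hb.onePhase_longHorizon
  refine ⟨_, hz0, le_antisymm (le_csInf ⟨_, _, hz0, rfl⟩ ?_) (hb.mStar_le hz0)⟩
  rintro _ ⟨x, hx, rfl⟩
  exact hz x hx

lemma Standing.sum_const (hD : D.Standing) (ts : ℝ) :
    ∑ _i : Fin N, D.l D.ρmin * ((D.tf - ts) / N) + ts * D.l D.ρmin = D.tf * D.l D.ρmin := by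
  have : (N : ℝ) ≠ 0 := Nat.cast_ne_zero.2 hD.N_pos.ne'
  rw [Finset.sum_const, Finset.card_univ, Fintype.card_fin, nsmul_eq_mul]
  field_simp
  ring

/-- Without a first phase the optimal value is at most the lower bound. -/
lemma LongHorizonAssumption.value_zero_le (hD : D.Standing) {tb : ℝ}
    (hb : D.LongHorizonAssumption tb) : (D.twoPhase 0).value ≤ D.mStar + D.tf * D.l D.ρmin := by
  obtain ⟨⟨x, u, σ⟩, hopt, hσ, hterm⟩ := hb.onePhase_longHorizon
  obtain ⟨hx, hf, -⟩ := (D.onePhase.isOptimal_iff x u σ).1 hopt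
  have hend : (D.twoPhase 0).endpoint u = D.onePhase.endpoint u := by
    have h1 : D.xinit 0 = D.xs := by
      have h2 : D.expIntegral 0 = 0 := by ext i j; simp [expIntegral]
      simp [xinit, h2]
    rw [DiscProblem.endpoint_eq, DiscProblem.endpoint_eq]
    simp [twoPhase, onePhase, h1]
  -- Only feasibility, minimal slacks and terminal optimality of the one-phase solution enter, so
  -- `l₀` need not be related to `l`.
  have hf' : (D.prob (D.phaseParams 0)).CtrlFeasible u σ := ⟨hf.1, by
    rw [← twoPhase_eq_prob, hend]; exact hf.2⟩
  obtain ⟨x', u', σ', h'⟩ := (hb.tame hD).exists_isOptimal hf'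
  rw [twoPhase_eq_prob, (D.prob (D.phaseParams 0)).value_eq h']
  refine ((((D.prob (D.phaseParams 0)).isOptimal_iff _ _ _).1 h').2.2 u σ hf').trans ?_
  rw [← twoPhase_eq_prob, DiscProblem.ctrlObjective, hend]
  have hm : D.m (D.onePhase.endpoint u) ≤ D.mStar := by
    obtain ⟨y, hy, hym⟩ := hb.exists_minimizer
    rw [← hym]
    have := hterm.2 y hy
    simp only [hx] at this
    exact this
  have hsum := hD.sum_const 0
  have hσ' : ∀ i, σ i = D.ρmin := hσ
  simp only [twoPhase, hσ']
  linarith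

/-- Optimal controls of a two-phase problem whose value is close to the lower bound. -/
lemma LongHorizonAssumption.near_minimal (hD : D.Standing) {tb : ℝ}
    (hb : D.LongHorizonAssumption tb) {L : ℝ} (hL : 0 < L)
    (hl : ∀ s ∈ Icc D.ρmin D.ρmax, L ≤ derivWithin D.l (Ici D.ρmin) s) {ε ts : ℝ} (hε : 0 < ε)
    (hts : ts < tb)
    (hv : (D.twoPhase ts).value <
      D.mStar + D.tf * D.l D.ρmin + min ε (L * ε * ((D.tf - tb) / N)))
    {x : Fin (N + 1) → Vec nx} {u : Fin N → Vec nu} {σ : Fin N → ℝ}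
    (hopt : (D.twoPhase ts).IsOptimal (x, u, σ)) :
    (∀ i, D.g (u i) < D.ρmin + ε) ∧ D.m ((D.twoPhase ts).endpoint u) < D.mStar + ε := by
  obtain ⟨-, hf, -⟩ := ((D.twoPhase ts).isOptimal_iff _ _ _).1 hopt
  rw [(D.twoPhase ts).value_eq hopt] at hv
  have hV : ∀ i, D.ρmin ≤ σ i ∧ σ i ≤ D.ρmax ∧ D.g (u i) ≤ σ i := hf.1
  have hN : (0 : ℝ) < N := Nat.cast_pos.2 hD.N_pos
  have htb := hb.tb_lt
  set c := (D.tf - ts) / (N : ℝ) with hc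
  have hc0 : 0 < c := div_pos (by linarith) hN
  -- The step length at `tb` bounds the one at `ts` from below, so the tolerance can be fixed before
  -- `ts` is known.
  have hcb : (D.tf - tb) / (N : ℝ) ≤ c := by rw [hc]; gcongr
  have hgrow : ∀ i, L * (σ i - D.ρmin) ≤ D.l (σ i) - D.l D.ρmin := fun i =>
    mul_sub_le_of_le_derivWithin (hb.contDiffOn_l hD) hl le_rfl (hV i).1 (hV i).2.1
  have hnn : ∀ i, 0 ≤ (D.l (σ i) - D.l D.ρmin) * c := fun i =>
    mul_nonneg ((mul_nonneg hL.le (sub_nonneg.2 (hV i).1)).trans (hgrow i)) hc0.le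
  have hm : D.mStar ≤ D.m ((D.twoPhase ts).endpoint u) := hb.mStar_le hf.2
  have hsum := hD.sum_const ts
  rw [← hc] at hsum
  -- The excess over the lower bound is a sum of nonnegative terms, so the tolerance bounds each of
  -- them.
  have hobj : (D.twoPhase ts).ctrlObjective u σ = D.m ((D.twoPhase ts).endpoint u) +
      ∑ i, (D.l (σ i) - D.l D.ρmin) * c + D.tf * D.l D.ρmin := by
    simp only [sub_mul, Finset.sum_sub_distrib]
    rw [← hsum]
    simp only [DiscProblem.ctrlObjective, twoPhase, ← hc]
    ring
  have hsn : 0 ≤ ∑ i, (D.l (σ i) - D.l D.ρmin) * c := Finset.sum_nonneg fun i _ => hnn i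
  have h1 := min_le_left ε (L * ε * ((D.tf - tb) / N))
  have h2 := min_le_right ε (L * ε * ((D.tf - tb) / N))
  refine ⟨fun i => ?_, by linarith⟩
  have h3 := Finset.single_le_sum (fun j _ => hnn j) (Finset.mem_univ i)
  have h4 : L * ε * ((D.tf - tb) / N) ≤ L * ε * c :=
    mul_le_mul_of_nonneg_left hcb (by positivity)
  have h5 : L * (σ i - D.ρmin) * c < L * ε * c := by
    have := mul_le_mul_of_nonneg_right (hgrow i) hc0.le
    linarith
  have h6 : σ i - D.ρmin < ε := by
    have := lt_of_mul_lt_mul_right h5 hc0.le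
    exact lt_of_mul_lt_mul_left this hL.le
  linarith [(hV i).2.2]

/-- There is a switching time at which the optimal value exceeds the lower bound by little. -/
lemma LongHorizonAssumption.exists_switch (hD : D.Standing) {tb : ℝ}
    (hb : D.LongHorizonAssumption tb) {η : ℝ} (hη : 0 < η) :
    ∃ ts ∈ Ioo 0 tb, D.mStar + D.tf * D.l D.ρmin < (D.twoPhase ts).value ∧
      (D.twoPhase ts).value < D.mStar + D.tf * D.l D.ρmin + η := by
  have hcont : ContinuousOn (fun ts => (D.twoPhase ts).value) (Icc 0 tb) := fun ts hts =>
    (ContinuousAt.comp (f := D.phaseParams) (g := fun p => (D.prob p).value)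
      ((hb.tame hD).continuousAt_value (hb.fullRowRank ts hts) (hb.slater ts hts))
      continuous_phaseParams.continuousAt).continuousWithinAt
  obtain ⟨y, hy1, hy2⟩ := exists_between (lt_min hb.value_gt (lt_add_of_pos_right
    (D.mStar + D.tf * D.l D.ρmin) hη))
  obtain ⟨ts, hts, rfl⟩ := intermediate_value_Ioo hb.tb_pos.le hcont
    ⟨(hb.value_zero_le hD).trans_lt hy1, hy2.trans_le (min_le_left _ _)⟩
  exact ⟨ts, hts, hy1, hy2.trans_le (min_le_right _ _)⟩

end SystemData

/-- If at least `n` controls violate the lower bound, they steer in every direction. -/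
lemma exists_steer_of_ncard {nx nu N : ℕ} (A : Matrix (Fin nx) (Fin nx) ℝ)
    (B : Matrix (Fin nx) (Fin nu) ℝ) {I : Set (Fin N)} (hI : nx ≤ I.ncard)
    (hK : ∀ K ∈ (Finset.range N).powersetCard nx, ∀ v : Fin nx → ℝ,
      (∀ e ∈ K, v ᵥ* (A ^ e * B) = 0) → v = 0) (y : Vec nx) :
    ∃ w : Fin N → Vec nu, (∀ i ∉ I, w i = 0) ∧ steer A B w = y := by
  classical
  refine exists_steer_eq A B I (fun v hv => ?_) y
  -- Control `i` enters through the power `N - 1 - i`, so distinct indices give distinct powers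
  -- below `N`.
  have hinj : Function.Injective fun i : Fin N => N - 1 - (i : ℕ) := fun i j hij => by
    simp only at hij
    exact Fin.ext (by omega)
  rw [Set.ncard_eq_toFinset_card', ← Finset.card_image_of_injective _ hinj] at hI
  obtain ⟨K, hKI, hKc⟩ := Finset.exists_subset_card_eq hI
  refine hK K (Finset.mem_powersetCard.2 ⟨fun e he => ?_, hKc⟩) v fun e he => ?_
  · obtain ⟨i, -, rfl⟩ := Finset.mem_image.1 (hKI he)
    exact Finset.mem_range.2 (by omega)
  · obtain ⟨i, hi, rfl⟩ := Finset.mem_image.1 (hKI he)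
    exact hv i (by simpa using hi)

end LCvx

end

open LCvx LCvx.SystemData Filter Topology

theorem mainTheorem2 {nx nu nG N : ℕ} (D : LCvx.SystemData nx nu nG N) (hD : D.Standing)
    (tb : ℝ) (hb : D.LongHorizonAssumption tb)
    (L : ℝ) (hL : 0 < L)
    (hl : ∀ σ ∈ Set.Icc D.ρmin D.ρmax, L ≤ derivWithin D.l (Set.Ici D.ρmin) σ)
    (ε : ℝ) (hε : 0 < ε) :
    ∃ ts ∈ Set.Ioo 0 tb,
      ∀ Q J : Matrix (Fin nx) (Fin nx) ℂ, LCvx.IsJordanForm (D.twoPhase ts).A Q J →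
      ∀ γ : ℝ, 0 < γ → ∃ δ : ℝ, 0 < δ ∧
        (∀ q : LCvx.shifts (D.twoPhase ts).A, ‖q‖ < δ →
          ∃ A' : Matrix (Fin nx) (Fin nx) ℝ, LCvx.IsPerturbation Q J q A' ∧
            (∃ z, ((D.twoPhase ts).withA A').IsOptimal z) ∧
            ∀ x u σ, ((D.twoPhase ts).withA A').IsOptimal (x, u, σ) →
              ‖D.G ((D.twoPhase ts).endpoint u)‖ ≤ γ ∧
              (∀ i, D.g (u i) < D.ρmin + ε) ∧
              D.m ((D.twoPhase ts).endpoint u) < D.mStar + ε) ∧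
        (∀ᵐ q ∂(LCvx.uniformBall (D.twoPhase ts).A δ),
          ∀ A' : Matrix (Fin nx) (Fin nx) ℝ, LCvx.IsPerturbation Q J q A' →
            ∀ x u σ, ((D.twoPhase ts).withA A').IsOptimal (x, u, σ) →
              {i | D.g (u i) < D.ρmin}.ncard + 1 ≤ nx) := by
  have hN : (0 : ℝ) < N := Nat.cast_pos.2 hD.N_pos
  have htb := hb.tb_lt
  have hη : 0 < min ε (L * ε * ((D.tf - tb) / N)) :=
    lt_min hε (mul_pos (mul_pos hL hε) (div_pos (by linarith) hN))
  obtain ⟨ts, hts, hlow, hup⟩ := hb.exists_switch hD hη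
  have hts' : ts ∈ Icc 0 tb := ⟨hts.1.le, hts.2.le⟩
  have hT := hb.tame hD
  refine ⟨ts, hts, fun Q J hJ γ hγ => ?_⟩
  let P : shifts (D.twoPhase ts).A → Params nx nu := fun q =>
    (perturbed Q J q, (D.phaseParams ts).2)
  have hPc : Continuous P := continuous_perturbed.prodMk continuous_const
  have hP0 : P 0 = D.phaseParams ts := Prod.ext hJ.perturbed_zero rfl
  have hgc := hT.g_cont
  have hmc := hT.m_cont
  have hGc : Continuous D.G := D.G.continuous_of_finiteDimensional
  -- The end point is taken with the unperturbed parameters, whereas the lower bound in `W` uses the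
  -- perturbed objective.
  let e : Params nx nu × Ctrl nu N → Vec nx := fun x => endp N (D.phaseParams ts) x.2.1
  have hec : Continuous e := Continuous.endp continuous_const (by fun_prop)
  let W : Set (Params nx nu × Ctrl nu N) := {x | (‖D.G (e x)‖ < γ ∧
    D.m (e x) < D.mStar + ε) ∧ (∀ i, D.g (x.2.1 i) < D.ρmin + ε) ∧
    D.mStar + D.tf * D.l D.ρmin < D.extObjective x.1 x.2}
  have hW : IsOpen W := by
    simp only [W, Set.ofPred_and, Set.ofPred_forall]
    refine ((isOpen_lt (hGc.comp hec).norm continuous_const).inter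
      (isOpen_lt (hmc.comp hec) continuous_const)).inter (IsOpen.inter ?_ ?_)
    · exact isOpen_iInter_of_finite fun i => isOpen_lt (hgc.comp (by fun_prop)) continuous_const
    · exact isOpen_lt continuous_const hT.continuous_extObjective
  have hopt : ∀ x u σ, (D.prob (D.phaseParams ts)).IsOptimal (x, u, σ) →
      (D.phaseParams ts, (u, σ)) ∈ W := fun x u σ h => by
    obtain ⟨h1, h2⟩ := hb.near_minimal hD hL hl hε hts.2 hup h
    have hf := (((D.prob (D.phaseParams ts)).isOptimal_iff _ _ _).1 h).2.1
    have h3 := hf.2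
    rw [endpoint_prob] at h3
    rw [twoPhase_eq_prob, endpoint_prob] at h2
    rw [twoPhase_eq_prob, DiscProblem.value_eq _ h, ctrlObjective_eq_extObjective hf] at hlow
    refine ⟨⟨?_, h2⟩, h1, hlow⟩
    change D.G _ = 0 at h3
    change ‖D.G (endp N (D.phaseParams ts) u)‖ < γ
    rwa [h3, norm_zero]
  have hev := hT.eventually_optimal (p₀ := D.phaseParams ts) (hb.fullRowRank ts hts') (hb.slater ts hts') hW hopt
  rw [← hP0] at hev
  obtain ⟨δ, hδ, hball⟩ := Metric.eventually_nhds_iff.1 (hPc.continuousAt.eventually hev)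
  refine ⟨δ, hδ, fun q hq => ?_, ?_⟩
  · obtain ⟨⟨x, u, σ, h⟩, hall⟩ := hball (y := q) (by simpa using hq)
    refine ⟨perturbed Q J q, hJ.isPerturbation q, ⟨_, h⟩, fun x u σ h => ?_⟩
    obtain ⟨⟨h1, h2⟩, h3, -⟩ := hall x u σ h
    rw [twoPhase_eq_prob, endpoint_prob]
    exact ⟨h1.le, h3, h2⟩
  · have h1 := (ProbabilityTheory.cond_absolutelyContinuous (s := Metric.ball 0 δ)).ae_le
      (ae_spanning (hb.controllable ts hts') hJ N)
    have h2 := ProbabilityTheory.ae_cond_mem (μ := (Measure.addHaar : Measure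
      (shifts (D.twoPhase ts).A))) (Metric.isOpen_ball (x := 0) (ε := δ)).measurableSet
    filter_upwards [h1, h2] with q hspan hq A' hA' x u σ h
    obtain rfl := hA'.eq (hJ.isPerturbation q)
    obtain ⟨-, -, hval⟩ := (hball hq).2 x u σ h
    -- With `nx` violations every slack is `ρmin` and the terminal cost is at most `mStar`, so the
    -- objective is at most the bound that `hval` says it exceeds.
    by_contra hcard
    have hlmono : StrictMonoOn D.l (Icc D.ρmin D.ρmax) := fun s hs t ht hst => by
      have h3 := mul_sub_le_of_le_derivWithin (hb.contDiffOn_l hD) hl hs.1 hst.le ht.2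
      have h4 := mul_pos hL (sub_pos.2 hst)
      linarith
    have hc : 0 < (P q).2.2.2.1 := div_pos (by linarith [hts.2]) hN
    obtain ⟨hσ, hm⟩ := hT.minimal_of_steer hD.m_convex hlmono hc hD.g_us.le h
      (exists_steer_of_ncard _ _ (by omega) (hspan _ hA'))
    obtain ⟨y, hy, hym⟩ := hb.exists_minimizer
    have h5 := hm y hy
    have h6 := hD.sum_const ts
    have h7 : D.extObjective (P q) (u, σ) =
        D.m (endp N (P q) u) + (∑ _i : Fin N, D.l D.ρmin * ((D.tf - ts) / N) +
          ts * D.l D.ρmin) := by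
      simp only [extObjective, hσ, max_self]
      exact add_assoc _ _ _
    rw [h7, h6] at hval
    linarith
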